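/- Let $\mathcal H$ be a complex Hilbert space, $\hbar>0$, and let $H$ be the (time-independent, in general unbounded) self-adjoint Hamiltonian of a closed quantum system with state space $\mathcal H$, with domain $D(H)$ and unitary evolution $U(t)=e^{-\frac{i}{\hbar}tH}$, $t\in\mathbb R$. A generalized state vector (ket) $|\psi\rangle$ is a bounded antilinear functional $\varphi\mapsto\langle\varphi|\psi\rangle$ on $D(H)$ with its graph norm (an element of $D(H)^*$ in the rigged triple $D(H)\subseteq\mathcal H\subseteq D(H)^*$); it evolves to $|\psi(t)\rangle=U(t)|\psi\rangle$, where $\langle\varphi|\psi(t)\rangle:=\langle U(-t)\varphi|\psi\rangle$. For $f\in C_c^\infty(\mathbb R,\mathbb C)$ a vector $v\in\mathcal H$ is written $\psi[f]=\int f(t)|\psi(t)\rangle\,dt$ if $\langle\varphi,v\rangle=\int f(t)\langle\varphi|\psi(t)\rangle\,dt$ for all $\varphi\in D(H)$. For an open set $J\subseteq\mathbb R$, $|\psi(s)\rangle$ is called orthogonal to the states $|\psi(t)\rangle$, $t\in J$, if the distribution $t\mapsto\langle\psi(s)|\psi(t)\rangle$ vanishes on $J$, that is, $\langle\psi[f]\,|\,\psi(s)\rangle=0$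 for every $f\in C_c^\infty(\mathbb R,\mathbb C)$ with support in $J$. Let $|\psi\rangle\neq0$ be a generalized state vector such that $|\psi(0)\rangle$ is orthogonal to all its past states ($t<0$), or to all its future states ($t>0$). Then: 1. For every $f\in C_c^\infty(\mathbb R,\mathbb C)$ the vector $\psi[f]$ exists and lies in $D(H)$, and states at distinct times are orthogonal: for every $s\in\mathbb R$, $|\psi(s)\rangle$ is orthogonal to the states $|\psi(t)\rangle$, $t\neq s$. 2. The Hilbert space $\mathcal V:=\overline{\mathrm{span}}\{\psi[f] : f\in C_c^\infty(\mathbb R,\mathbb C)\}$ spanned by the history is invariant under every $U(t)$, and $H$ maps $D(H)\cap\mathcal V$ into $\mathcal V$. 3. There is a unitary $W:\mathcal V\to L^2(\mathbb R,\mathbb C)$ such that (a) for some constant $c>0$, $W\psi[f]=c\,f$ for all $f\in C_c^\infty(\mathbb R,\mathbb C)$ (so $|\psi(t)\rangle$ corresponds to $c$ times the Dirac ket $|\tau=t\rangle$); (b) the evolution acts as translation: $(WU(t)x)(\tau)=(Wx)(\tau-t)$ for all $x\in\mathcal V$, $t\in\mathbb R$ and almost every $\tau$; (c) the restriction of $H$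 to $\mathcal V$ is $-i\hbar\,\frac{\partial}{\partial\tau}$: for $x,y\in\mathcal V$ one has $x\in D(H)$ and $Hx=y$ if and only if $Wx$ has a weak derivative $(Wx)'\in L^2(\mathbb R)$ and $Wy=-i\hbar\,(Wx)'$. In particular the domain of the restriction corresponds to the Sobolev space $H^1(\mathbb R)$. -/

import Mathlib

open MeasureTheory
open scoped ContDiff InnerProductSpace

noncomputable section

namespace QuantumHistory

/-- A strongly continuous one-parameter group of unitary operators on a Hilbert space. -/
structure UnitaryGroup (𝓗 : Type*) [NormedAddCommGroup 𝓗] [InnerProductSpace ℂ 𝓗] where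
  /-- the evolution operator from time `0` to time `t` -/
  op : ℝ → (𝓗 ≃ₗᵢ[ℂ] 𝓗)
  op_add : ∀ (s t : ℝ) (x : 𝓗), op (s + t) x = op s (op t x)
  continuous_op : ∀ x : 𝓗, Continuous fun t => op t x

variable {𝓗 : Type*} [NormedAddCommGroup 𝓗] [InnerProductSpace ℂ 𝓗]

/-- `H` is the Hamiltonian of the evolution `U`: a vector `x` lies in the domain of `H` exactly
when `t ↦ U(t) x` is differentiable at `0`, and then `iħ (d/dt) U(t) x = H x` at `t = 0`.
By Stone's theorem these are exactly the pairs of a self-adjoint `H` (in general unbounded)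
and `U(t) = exp(-itH/ħ)`. -/
def IsHamiltonian (ħ : ℝ) (H : 𝓗 →ₗ.[ℂ] 𝓗) (U : UnitaryGroup 𝓗) : Prop :=
  ∀ x y : 𝓗, (x, y) ∈ H.graph ↔
    HasDerivAt (fun t : ℝ => U.op t x) ((-Complex.I / (ħ : ℂ)) • y) 0

/-- The evolution commutes with its Hamiltonian. -/
theorem IsHamiltonian.mem_graph {ħ : ℝ} {H : 𝓗 →ₗ.[ℂ] 𝓗} {U : UnitaryGroup 𝓗}
    (hH : IsHamiltonian ħ H U) (s : ℝ) {x y : 𝓗} (h : (x, y) ∈ H.graph) :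
    (U.op s x, U.op s y) ∈ H.graph := by
  rw [hH] at h ⊢
  have h2 := ((U.op s).toContinuousLinearEquiv.toContinuousLinearMap.restrictScalars
    ℝ).hasFDerivAt.comp_hasDerivAt (0 : ℝ) h
  have e : (fun t : ℝ => U.op t (U.op s x)) = fun t : ℝ => U.op s (U.op t x) := by
    funext t
    rw [← U.op_add, ← U.op_add, add_comm]
  rw [e]
  simpa [Function.comp_def] using h2

theorem IsHamiltonian.op_mem {ħ : ℝ} {H : 𝓗 →ₗ.[ℂ] 𝓗} {U : UnitaryGroup 𝓗}
    (hH : IsHamiltonian ħ H U) (s : ℝ) (x : H.domain) : U.op s (x : 𝓗) ∈ H.domain :=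
  H.mem_domain_of_mem_graph (hH.mem_graph s (H.mem_graph x))

theorem IsHamiltonian.apply_op {ħ : ℝ} {H : 𝓗 →ₗ.[ℂ] 𝓗} {U : UnitaryGroup 𝓗}
    (hH : IsHamiltonian ħ H U) (s : ℝ) (x : H.domain) :
    H ⟨U.op s (x : 𝓗), hH.op_mem s x⟩ = U.op s (H x) :=
  H.mem_graph_snd_inj (H.mem_graph ⟨U.op s (x : 𝓗), hH.op_mem s x⟩)
    (hH.mem_graph s (H.mem_graph x)) rfl

/-- A generalized state vector (ket) `|ψ⟩` of the system with Hamiltonian `H`: a bounded antilinear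
functional `φ ↦ ⟨φ|ψ⟩` on the domain of `H` with its graph norm, i.e. an element of the last
space of the rigged triple `D(H) ⊆ 𝓗 ⊆ D(H)*`. A vector `x` of `𝓗` is the ket `φ ↦ ⟪φ, x⟫`; for
`H = -iħ d/dτ` on `L²(ℝ)` the Dirac kets `|τ⟩`, `φ ↦ conj (φ τ)`, are of this kind. -/
structure Ket (H : 𝓗 →ₗ.[ℂ] 𝓗) where
  /-- the antilinear functional `φ ↦ ⟨φ|ψ⟩` -/
  amp : H.domain →ₗ⋆[ℂ] ℂ
  bounded : ∃ C : ℝ, ∀ φ : H.domain, ‖amp φ‖ ≤ C * (‖(φ : 𝓗)‖ + ‖H φ‖)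

/-- The state `|ψ(t)⟩ = U(t)|ψ⟩`, that is `⟨φ|ψ(t)⟩ = ⟨U(-t)φ|ψ⟩`. -/
def Ket.evolve {ħ : ℝ} {H : 𝓗 →ₗ.[ℂ] 𝓗} {U : UnitaryGroup 𝓗}
    (hH : IsHamiltonian ħ H U) (ψ : Ket H) (t : ℝ) : Ket H where
  amp :=
    { toFun := fun φ => ψ.amp ⟨U.op (-t) (φ : 𝓗), hH.op_mem (-t) φ⟩
      map_add' := fun φ χ => by
        rw [← map_add]
        congr 1
        exact Subtype.ext (by simp)
      map_smul' := fun a φ => by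
        rw [← map_smulₛₗ]
        congr 1
        exact Subtype.ext (by simp) }
  bounded := by
    obtain ⟨C, hC⟩ := ψ.bounded
    refine ⟨C, fun φ => ?_⟩
    have h := hC ⟨U.op (-t) (φ : 𝓗), hH.op_mem (-t) φ⟩
    rw [hH.apply_op] at h
    simpa using h

/-- Test functions on the time line: smooth with compact support. -/
def IsTest (f : ℝ → ℂ) : Prop := ContDiff ℝ ∞ f ∧ HasCompactSupport f

/-- `v` is the superposition (wave packet) `∫ f(t) |ψ(t)⟩ dt` of the states in the history of
`ψ`: `⟪φ, v⟫ = ∫ f(t) ⟨φ|ψ(t)⟩ dt` for all `φ` in the domain of `H`. -/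
def IsPacket {ħ : ℝ} {H : 𝓗 →ₗ.[ℂ] 𝓗} {U : UnitaryGroup 𝓗}
    (hH : IsHamiltonian ħ H U) (ψ : Ket H) (f : ℝ → ℂ) (v : 𝓗) : Prop :=
  ∀ φ : H.domain, ⟪(φ : 𝓗), v⟫_ℂ = ∫ t : ℝ, f t * (ψ.evolve hH t).amp φ

/-- `|ψ(s)⟩` is orthogonal to `|ψ(t)⟩` for all `t` in the open set `J`: the distribution
`t ↦ ⟨ψ(s)|ψ(t)⟩` vanishes on `J`, i.e. `|ψ(s)⟩` is orthogonal to every superposition of the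
states `|ψ(t)⟩`, `t ∈ J`. For `ψ` in `𝓗` this says `⟪ψ(s), ψ(t)⟫ = 0` for all `t ∈ J`. -/
def IsOrthogonalOn {ħ : ℝ} {H : 𝓗 →ₗ.[ℂ] 𝓗} {U : UnitaryGroup 𝓗}
    (hH : IsHamiltonian ħ H U) (ψ : Ket H) (s : ℝ) (J : Set ℝ) : Prop :=
  ∀ f : ℝ → ℂ, IsTest f → tsupport f ⊆ J →
    ∀ v : H.domain, IsPacket hH ψ f (v : 𝓗) → (ψ.evolve hH s).amp v = 0

/-- The Hilbert space spanned by the states in the history of `ψ`: the closed linear span of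
their superpositions. -/
def historySpan {ħ : ℝ} {H : 𝓗 →ₗ.[ℂ] 𝓗} {U : UnitaryGroup 𝓗}
    (hH : IsHamiltonian ħ H U) (ψ : Ket H) : Submodule ℂ 𝓗 :=
  (Submodule.span ℂ {v : 𝓗 | ∃ f : ℝ → ℂ, IsTest f ∧ IsPacket hH ψ f v}).topologicalClosure

/-- `g' ∈ L²(ℝ)` is the weak derivative of `g ∈ L²(ℝ)`. -/
def HasWeakDeriv (g g' : Lp ℂ 2 (volume : Measure ℝ)) : Prop :=
  ∀ φ : ℝ → ℂ, IsTest φ → ∫ τ : ℝ, deriv φ τ * g τ = -∫ τ : ℝ, φ τ * g' τ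

end QuantumHistory

end

/-! By Hahn–Banach and Riesz on the graph of `H`, the ket is `φ ↦ ⟪φ, a⟫ + ⟪H φ, b⟫` for some
vectors `a`, `b` (`Ket.exists_amp_eq`). Integration by parts turns the `H` in the second term into a
derivative of the profile, so every packet is given by an explicit integral, lies in `D(H)`, and
satisfies `H ψ[f] = -iħ ψ[f']`.

Everything is then governed by the antilinear distribution `T f = ⟨ψ[f]|ψ⟩` (`correlation`), since
`⟪ψ[f], ψ[g]⟫ = ∫ g(s) T(f(· + s)) ds` (`inner_packet_packet`). Hermitian symmetry of this form
carries vanishing of `T` on one half-line to the other, so `T` is supported at the origin. It is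
bounded in the `W^{2,1}` norm, which controls `f 0` and `f' 0` but not `f'' 0`; hence `T` is a
combination of `δ` and `δ'` (`exists_eq_dirac_add_deriv_dirac`). Positivity on rapidly oscillating
profiles excludes `δ'`, and a vanishing coefficient of `δ` would make all packets, hence the ket,
zero. So `T = c² δ` with `c > 0` (`exists_correlation_eq_dirac`).

Consequently `⟪ψ[f], ψ[g]⟫ = c² ⟪f, g⟫` in `L²`, and `ψ[f] ↦ c f` extends by density to the unitary
`W`. Evolution shifts profiles, hence acts as translation. Symmetry of `H` against packets is the
weak derivative identity, and conversely the packets, being invariant under `U`, form a core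
(`IsHamiltonian.mem_graph_of_forall_inner`). -/

noncomputable section

namespace QuantumHistory

section TestFunctions

/-! ### Test functions -/

namespace IsTest

variable {f g : ℝ → ℂ}

theorem continuous (hf : IsTest f) : Continuous f := hf.1.continuous

theorem differentiable (hf : IsTest f) : Differentiable ℝ f := hf.1.differentiable (by simp)

theorem deriv (hf : IsTest f) : IsTest (deriv f) :=
  ⟨(contDiff_infty_iff_deriv.1 hf.1).2, hf.2.deriv⟩

theorem add (hf : IsTest f) (hg : IsTest g) : IsTest fun t => f t + g t :=
  ⟨hf.1.add hg.1, hf.2.add hg.2⟩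

theorem const_mul (c : ℂ) (hf : IsTest f) : IsTest fun t => c * f t :=
  ⟨contDiff_const.mul hf.1, hf.2.mul_left⟩

theorem mul_left (hg : ContDiff ℝ ∞ g) (hf : IsTest f) : IsTest fun t => g t * f t :=
  ⟨hg.mul hf.1, hf.2.mul_left⟩

theorem comp_add_right (hf : IsTest f) (s : ℝ) : IsTest fun t => f (t + s) :=
  ⟨hf.1.comp (contDiff_id.add contDiff_const), hf.2.comp_homeomorph (Homeomorph.addRight s)⟩

theorem comp_sub_right (hf : IsTest f) (s : ℝ) : IsTest fun t => f (t - s) := by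
  simpa [sub_eq_add_neg] using hf.comp_add_right (-s)

theorem conj (hf : IsTest f) : IsTest fun t => (starRingEnd ℂ) (f t) :=
  ⟨Complex.conjCLE.contDiff.comp hf.1, hf.2.comp_left (map_zero _)⟩

theorem ofReal {f : ℝ → ℝ} (hf : ContDiff ℝ ∞ f) (hc : HasCompactSupport f) :
    IsTest fun t => (f t : ℂ) :=
  ⟨Complex.ofRealCLM.contDiff.comp hf, hc.comp_left Complex.ofReal_zero⟩

theorem integrable_smul {E : Type*} [NormedAddCommGroup E] [NormedSpace ℂ E] (hf : IsTest f)
    {k : ℝ → E} (hk : Continuous k) : Integrable fun t => f t • k t :=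
  (hf.continuous.smul hk).integrable_of_hasCompactSupport hf.2.smul_right

end IsTest

/-- A function continuous on the line that integrates to zero against all test functions supported
in an open set vanishes there. -/
theorem eqOn_zero_of_integral_test_mul_eq_zero {k : ℝ → ℂ} (hk : Continuous k) {J : Set ℝ}
    (hJ : IsOpen J)
    (h : ∀ f : ℝ → ℂ, IsTest f → tsupport f ⊆ J → ∫ t, f t * k t = 0) :
    Set.EqOn k 0 J := by
  have h1 : ∀ᵐ t ∂(volume : Measure ℝ), t ∈ J → k t = 0 := by
    refine hJ.ae_eq_zero_of_integral_contDiff_smul_eq_zero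
      (hk.locallyIntegrable.locallyIntegrableOn J) fun g hg hgc hgs => ?_
    have := h _ (IsTest.ofReal hg hgc)
      ((tsupport_comp_subset (g := Complex.ofReal) Complex.ofReal_zero g).trans hgs)
    simpa [Complex.real_smul] using this
  refine Measure.eqOn_open_of_ae_eq (μ := volume) ?_ hJ hk.continuousOn continuousOn_const
  exact (ae_restrict_iff' hJ.measurableSet).2 h1

variable {𝓗 : Type*} [NormedAddCommGroup 𝓗] [InnerProductSpace ℂ 𝓗]

/-! ### Unitary groups and smeared vectors -/

namespace UnitaryGroup

variable (U : UnitaryGroup 𝓗)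

theorem op_zero (x : 𝓗) : U.op 0 x = x := by
  apply (U.op 0).injective
  rw [← U.op_add, add_zero]

theorem op_neg_op (t : ℝ) (x : 𝓗) : U.op (-t) (U.op t x) = x := by
  rw [← U.op_add, neg_add_cancel, U.op_zero]

theorem inner_op_left (t : ℝ) (x y : 𝓗) : ⟪U.op t x, y⟫_ℂ = ⟪x, U.op (-t) y⟫_ℂ := by
  rw [← (U.op (-t)).inner_map_map, U.op_neg_op]

theorem inner_op_neg_left (t : ℝ) (x y : 𝓗) : ⟪U.op (-t) x, y⟫_ℂ = ⟪x, U.op t y⟫_ℂ := by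
  rw [inner_op_left, neg_neg]

/-- The vector `∫ f(t) U(t) x dt`. -/
def smear (f : ℝ → ℂ) (x : 𝓗) : 𝓗 := ∫ t, f t • U.op t x

variable {U} {f g : ℝ → ℂ} {x : 𝓗}

theorem integrable_smul_op (hf : IsTest f) (x : 𝓗) : Integrable fun t => f t • U.op t x :=
  hf.integrable_smul (U.continuous_op x)

theorem smear_add (hf : IsTest f) (hg : IsTest g) :
    U.smear (fun t => f t + g t) x = U.smear f x + U.smear g x := by
  simp only [smear, add_smul]
  exact integral_add (integrable_smul_op hf x) (integrable_smul_op hg x)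

theorem smear_const_mul (c : ℂ) (f : ℝ → ℂ) :
    U.smear (fun t => c * f t) x = c • U.smear f x := by
  simp only [smear, mul_smul, integral_smul]

theorem norm_smear_le (f : ℝ → ℂ) : ‖U.smear f x‖ ≤ (∫ t, ‖f t‖) * ‖x‖ := by
  refine (norm_integral_le_integral_norm _).trans_eq ?_
  simp [norm_smul, integral_mul_const]

variable [CompleteSpace 𝓗]

theorem op_smear (hf : IsTest f) (s : ℝ) :
    U.op s (U.smear f x) = U.smear (fun t => f (t - s)) x := by
  rw [smear, smear, ← integral_sub_right_eq_self (fun t => f t • U.op t x) s]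
  refine (((U.op s).toContinuousLinearEquiv.toContinuousLinearMap).integral_comp_comm
    ((integrable_smul_op (U := U) hf x).comp_sub_right s)).symm.trans ?_
  refine integral_congr_ae (Filter.Eventually.of_forall fun t => ?_)
  simp [← U.op_add]

theorem inner_smear (hf : IsTest f) (y : 𝓗) :
    ⟪y, U.smear f x⟫_ℂ = ∫ t, f t * ⟪y, U.op t x⟫_ℂ := by
  rw [smear, ← integral_inner (integrable_smul_op hf x)]
  simp [inner_smul_right]

/-- The function `s ↦ U(s) ∫ f(t) U(t) x dt` is the convolution of the orbit of `x` with `t ↦ f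
(-t)`, so the derivative falls on `f` and `x` may be arbitrary. -/
theorem hasDerivAt_op_smear (hf : IsTest f) (x : 𝓗) :
    HasDerivAt (fun s => U.op s (U.smear f x)) (-U.smear (deriv f) x) 0 := by
  have hg : ContDiff ℝ 1 fun t => f (-t) :=
    (hf.1.comp contDiff_neg).of_le (by exact_mod_cast le_top)
  have hgc : HasCompactSupport fun t => f (-t) := hf.2.comp_homeomorph (Homeomorph.neg ℝ)
  have h := hgc.hasDerivAt_convolution_right
    (ContinuousLinearMap.lsmul ℝ ℂ : ℂ →L[ℝ] 𝓗 →L[ℝ] 𝓗).flip (μ := volume)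
    (U.continuous_op x).locallyIntegrable hg 0
  convert h using 1
  · funext s
    rw [op_smear hf, smear, convolution]
    simp
  · rw [smear, convolution, ← integral_neg]
    refine integral_congr_ae (Filter.Eventually.of_forall fun t => ?_)
    simp [deriv_comp_neg]

end UnitaryGroup

/-! ### The Hamiltonian -/

namespace IsHamiltonian

variable {ħ : ℝ} {H : 𝓗 →ₗ.[ℂ] 𝓗} {U : UnitaryGroup 𝓗}

theorem hasDerivAt_op (hH : IsHamiltonian ħ H U) {x y : 𝓗} (h : (x, y) ∈ H.graph) (s : ℝ) :
    HasDerivAt (fun t => U.op t x) ((-Complex.I / ħ) • U.op s y) s := by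
  have h1 := (hH _ _).1 (hH.mem_graph s h)
  have h2 : HasDerivAt (fun t => U.op (t - s) (U.op s x)) ((-Complex.I / ħ) • U.op s y) s := by
    refine HasDerivAt.comp_sub_const s s (f := fun t => U.op t (U.op s x)) ?_
    rwa [sub_self]
  simpa [← U.op_add] using h2

theorem hasDerivAt_op_neg (hH : IsHamiltonian ħ H U) {x y : 𝓗} (h : (x, y) ∈ H.graph) (s : ℝ) :
    HasDerivAt (fun t => U.op (-t) x) ((Complex.I / ħ) • U.op (-s) y) s := by
  have h1 := (hH.hasDerivAt_op h (-s)).scomp s (hasDerivAt_neg s)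
  rwa [neg_smul, one_smul, ← neg_smul, neg_div, neg_neg] at h1

/-- The Hamiltonian is symmetric. -/
theorem inner_symm (hH : IsHamiltonian ħ H U) (hħ : ħ ≠ 0) {x x' y y' : 𝓗}
    (h : (x, y) ∈ H.graph) (h' : (x', y') ∈ H.graph) : ⟪y, x'⟫_ℂ = ⟪x, y'⟫_ℂ := by
  -- Unitarity makes `t ↦ ⟪U(t) x, U(t) x'⟫` constant, while the product rule gives its derivative
  -- at `0` as `(i/ħ) (⟪y, x'⟫ - ⟪x, y'⟫)`.
  have h1 := (hH.hasDerivAt_op h 0).inner ℂ (hH.hasDerivAt_op h' 0)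
  simp only [LinearIsometryEquiv.inner_map_map, U.op_zero] at h1
  have h2 := h1.unique (hasDerivAt_const _ _)
  simp only [inner_smul_left, inner_smul_right] at h2
  have h3 : (Complex.I / ħ) * (⟪y, x'⟫_ℂ - ⟪x, y'⟫_ℂ) = 0 := by
    rw [← h2]
    simp
    ring
  have : (ħ : ℂ) ≠ 0 := by exact_mod_cast hħ
  rcases mul_eq_zero.1 h3 with h3 | h3
  · simp [this] at h3
  · exact sub_eq_zero.1 h3

variable [CompleteSpace 𝓗]

theorem smear_mem_graph (hH : IsHamiltonian ħ H U) (hħ : ħ ≠ 0) {f : ℝ → ℂ} (hf : IsTest f)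
    (x : 𝓗) : (U.smear f x, (-Complex.I * ħ) • U.smear (deriv f) x) ∈ H.graph := by
  rw [hH, smul_smul]
  convert UnitaryGroup.hasDerivAt_op_smear hf x using 1
  have : (ħ : ℂ) ≠ 0 := by exact_mod_cast hħ
  have e : -Complex.I / (ħ : ℂ) * (-Complex.I * ħ) = -1 := by
    field_simp
    simp
  rw [e, neg_one_smul]

/-- The domain of the Hamiltonian is dense. -/
theorem eq_zero_of_forall_inner_eq_zero (hH : IsHamiltonian ħ H U) (hħ : ħ ≠ 0) {y : 𝓗}
    (h : ∀ φ : H.domain, ⟪(φ : 𝓗), y⟫_ℂ = 0) : y = 0 := by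
  -- Smearing `y` itself gives domain vectors, all orthogonal to `y`; the continuous function below
  -- thus vanishes, and its value at `0` is `‖y‖²`.
  have h1 : Set.EqOn (fun t => ⟪y, U.op t y⟫_ℂ) 0 Set.univ := by
    refine eqOn_zero_of_integral_test_mul_eq_zero
      (continuous_const.inner (U.continuous_op y)) isOpen_univ fun f hf _ => ?_
    rw [← UnitaryGroup.inner_smear hf, ← inner_conj_symm,
      h ⟨_, H.mem_domain_of_mem_graph (hH.smear_mem_graph hħ hf y)⟩, map_zero]
  simpa [U.op_zero] using h1 (Set.mem_univ 0)

end IsHamiltonian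

end TestFunctions

section Packets

variable {𝓗 : Type*} [NormedAddCommGroup 𝓗] [InnerProductSpace ℂ 𝓗]

/-! ### Wave packets -/

/-- Every ket is of the form `φ ↦ ⟪φ, a⟫ + ⟪H φ, b⟫` with vectors `a`, `b` of `𝓗`. -/
theorem Ket.exists_amp_eq [CompleteSpace 𝓗] {H : 𝓗 →ₗ.[ℂ] 𝓗} (ψ : Ket H) :
    ∃ a b : 𝓗, ∀ φ : H.domain, ψ.amp φ = ⟪(φ : 𝓗), a⟫_ℂ + ⟪H φ, b⟫_ℂ := by
  obtain ⟨C, hC⟩ := ψ.bounded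
  let d : H.graph → H.domain := fun p => ⟨p.1.1, H.mem_domain_of_mem_graph p.2⟩
  have hd : ∀ p : H.graph, H (d p) = p.1.2 := fun p =>
    H.mem_graph_snd_inj (H.mem_graph (d p)) p.2 rfl
  let L : H.graph →ₗ[ℂ] ℂ :=
    { toFun := fun p => (starRingEnd ℂ) (ψ.amp (d p))
      map_add' := fun p q => by rw [← map_add, ← map_add]; rfl
      map_smul' := fun c p => by
        have : d (c • p) = c • d p := rfl
        rw [this, map_smulₛₗ]
        simp }
  -- The graph carries the sup norm of `𝓗 × 𝓗`, so each of the two terms is at most `‖p‖`, whence `2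
  -- * |C|`. The conjugate in `L` makes the functional linear; the vectors `a`, `b` represent the
  -- two components of its extension.
  obtain ⟨F, hF, -⟩ := exists_extension_norm_eq H.graph (L.mkContinuous (2 * |C|) fun p => by
    have h1 := hC (d p)
    rw [hd] at h1
    have h2 : ‖(d p : 𝓗)‖ ≤ ‖p‖ := norm_fst_le p.1
    have h3 : ‖p.1.2‖ ≤ ‖p‖ := norm_snd_le p.1
    calc ‖L p‖ = ‖ψ.amp (d p)‖ := RCLike.norm_conj _
      _ ≤ C * (‖(d p : 𝓗)‖ + ‖p.1.2‖) := h1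
      _ ≤ |C| * (‖p‖ + ‖p‖) := by
          gcongr
          exact le_abs_self C
      _ = 2 * |C| * ‖p‖ := by ring)
  refine ⟨(InnerProductSpace.toDual ℂ 𝓗).symm (F.comp (.inl ℂ 𝓗 𝓗)),
    (InnerProductSpace.toDual ℂ 𝓗).symm (F.comp (.inr ℂ 𝓗 𝓗)), fun φ => ?_⟩
  have h1 : F ((φ : 𝓗), H φ) = (starRingEnd ℂ) (ψ.amp φ) := hF ⟨_, H.mem_graph φ⟩
  rw [← inner_conj_symm, ← inner_conj_symm (H φ), InnerProductSpace.toDual_symm_apply,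
    InnerProductSpace.toDual_symm_apply, ← map_add, ← Complex.conj_conj (ψ.amp φ), ← h1]
  congr 1
  simp [← map_add]

/-- The wave packet `∫ f(t) |ψ(t)⟩ dt` of the ket `φ ↦ ⟪φ, a⟫ + ⟪H φ, b⟫`. -/
def packet (ħ : ℝ) (U : UnitaryGroup 𝓗) (a b : 𝓗) (f : ℝ → ℂ) : 𝓗 :=
  U.smear f a - (Complex.I * ħ) • U.smear (deriv f) b

/-- The pairing `⟨ψ[f]|ψ⟩` of a wave packet of the ket `φ ↦ ⟪φ, a⟫ + ⟪H φ, b⟫` with that ket. -/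
def correlation (ħ : ℝ) (U : UnitaryGroup 𝓗) (a b : 𝓗) (f : ℝ → ℂ) : ℂ :=
  ⟪packet ħ U a b f, a⟫_ℂ + ⟪(-Complex.I * ħ) • packet ħ U a b (deriv f), b⟫_ℂ

/-! ### Linearity, Sobolev bounds and covariance of packets and correlations -/

section

variable {ħ : ℝ} {U : UnitaryGroup 𝓗} {a b : 𝓗} {f g : ℝ → ℂ}

theorem packet_add (hf : IsTest f) (hg : IsTest g) :
    packet ħ U a b (fun t => f t + g t) = packet ħ U a b f + packet ħ U a b g := by
  have e : deriv (fun t => f t + g t) = fun t => deriv f t + deriv g t := by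
    funext t
    exact deriv_fun_add (hf.differentiable t) (hg.differentiable t)
  rw [packet, e, UnitaryGroup.smear_add hf hg, UnitaryGroup.smear_add hf.deriv hg.deriv, packet,
    packet]
  module

theorem packet_const_mul (c : ℂ) (hf : IsTest f) :
    packet ħ U a b (fun t => c * f t) = c • packet ħ U a b f := by
  have e : deriv (fun t => c * f t) = fun t => c * deriv f t := by
    funext t
    exact deriv_const_mul c (hf.differentiable t)
  rw [packet, e, UnitaryGroup.smear_const_mul, UnitaryGroup.smear_const_mul, packet]
  module

theorem correlation_add (hf : IsTest f) (hg : IsTest g) :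
    correlation ħ U a b (fun t => f t + g t) =
      correlation ħ U a b f + correlation ħ U a b g := by
  have e : deriv (fun t => f t + g t) = fun t => deriv f t + deriv g t := by
    funext t
    exact deriv_fun_add (hf.differentiable t) (hg.differentiable t)
  rw [correlation, e, packet_add hf hg, packet_add hf.deriv hg.deriv, correlation, correlation]
  simp only [smul_add, inner_add_left]
  ring

theorem correlation_const_mul (c : ℂ) (hf : IsTest f) :
    correlation ħ U a b (fun t => c * f t) = (starRingEnd ℂ) c * correlation ħ U a b f := by
  have e : deriv (fun t => c * f t) = fun t => c * deriv f t := by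
    funext t
    exact deriv_const_mul c (hf.differentiable t)
  rw [correlation, e, packet_const_mul c hf, packet_const_mul c hf.deriv, correlation]
  simp only [inner_smul_left]
  ring

theorem norm_packet_le (f : ℝ → ℂ) :
    ‖packet ħ U a b f‖ ≤ (‖a‖ + |ħ| * ‖b‖) * ((∫ t, ‖f t‖) + ∫ t, ‖deriv f t‖) := by
  have h1 : 0 ≤ ∫ t, ‖f t‖ := integral_nonneg fun _ => norm_nonneg _
  have h2 : 0 ≤ ∫ t, ‖deriv f t‖ := integral_nonneg fun _ => norm_nonneg _
  calc ‖packet ħ U a b f‖ ≤ ‖U.smear f a‖ + ‖(Complex.I * ħ) • U.smear (deriv f) b‖ :=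
        norm_sub_le _ _
    _ ≤ (∫ t, ‖f t‖) * ‖a‖ + |ħ| * ((∫ t, ‖deriv f t‖) * ‖b‖) := by
        rw [norm_smul]
        simp only [norm_mul, Complex.norm_I, one_mul, Complex.norm_real, Real.norm_eq_abs]
        gcongr
        · exact UnitaryGroup.norm_smear_le f
        · exact UnitaryGroup.norm_smear_le _
    _ ≤ _ := by
        have := mul_nonneg (norm_nonneg a) h2
        have := mul_nonneg (mul_nonneg (abs_nonneg ħ) (norm_nonneg b)) h1
        linarith

/-- The vector `b` costs one derivative in the packet and one more in the ket paired with it; two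
derivatives in `L¹` norm suffice. -/
theorem exists_norm_correlation_le (ħ : ℝ) (U : UnitaryGroup 𝓗) (a b : 𝓗) :
    ∃ C : ℝ, 0 ≤ C ∧ ∀ f : ℝ → ℂ, ‖correlation ħ U a b f‖ ≤
      C * ((∫ t, ‖f t‖) + (∫ t, ‖deriv f t‖) + ∫ t, ‖deriv (deriv f) t‖) := by
  refine ⟨(‖a‖ + |ħ| * ‖b‖) * (‖a‖ + |ħ| * ‖b‖), by positivity, fun f => ?_⟩
  have h0 : 0 ≤ ∫ t, ‖f t‖ := integral_nonneg fun _ => norm_nonneg _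
  have h2 : 0 ≤ ∫ t, ‖deriv (deriv f) t‖ := integral_nonneg fun _ => norm_nonneg _
  set N := (∫ t, ‖f t‖) + (∫ t, ‖deriv f t‖) + ∫ t, ‖deriv (deriv f) t‖ with hN
  have e1 : ‖packet ħ U a b f‖ ≤ (‖a‖ + |ħ| * ‖b‖) * N :=
    (norm_packet_le f).trans (by gcongr; linarith)
  have e2 : ‖packet ħ U a b (deriv f)‖ ≤ (‖a‖ + |ħ| * ‖b‖) * N :=
    (norm_packet_le _).trans (by gcongr; linarith)
  calc ‖correlation ħ U a b f‖
      ≤ ‖packet ħ U a b f‖ * ‖a‖ + (|ħ| * ‖packet ħ U a b (deriv f)‖) * ‖b‖ := by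
        refine (norm_add_le _ _).trans (add_le_add (norm_inner_le_norm _ _) ?_)
        refine (norm_inner_le_norm _ _).trans_eq ?_
        simp [norm_smul]
    _ ≤ ((‖a‖ + |ħ| * ‖b‖) * N) * ‖a‖ + (|ħ| * ((‖a‖ + |ħ| * ‖b‖) * N)) * ‖b‖ := by gcongr
    _ = _ := by ring

variable {H : 𝓗 →ₗ.[ℂ] 𝓗} {ψ : Ket H}

theorem Ket.amp_evolve {hH : IsHamiltonian ħ H U}
    (hab : ∀ φ : H.domain, ψ.amp φ = ⟪(φ : 𝓗), a⟫_ℂ + ⟪H φ, b⟫_ℂ) (t : ℝ) (φ : H.domain) :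
    (ψ.evolve hH t).amp φ = ⟪(φ : 𝓗), U.op t a⟫_ℂ + ⟪H φ, U.op t b⟫_ℂ := by
  change ψ.amp ⟨U.op (-t) (φ : 𝓗), hH.op_mem (-t) φ⟩ = _
  rw [hab, hH.apply_op, U.inner_op_neg_left, U.inner_op_neg_left]

theorem Ket.continuous_amp_evolve {hH : IsHamiltonian ħ H U}
    (hab : ∀ φ : H.domain, ψ.amp φ = ⟪(φ : 𝓗), a⟫_ℂ + ⟪H φ, b⟫_ℂ) (φ : H.domain) :
    Continuous fun t => (ψ.evolve hH t).amp φ := by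
  simp only [Ket.amp_evolve hab]
  exact (continuous_const.inner (U.continuous_op a)).add
    (continuous_const.inner (U.continuous_op b))

variable [CompleteSpace 𝓗]

theorem op_packet (hf : IsTest f) (s : ℝ) :
    U.op s (packet ħ U a b f) = packet ħ U a b fun t => f (t - s) := by
  have e : deriv (fun t => f (t - s)) = fun t => deriv f (t - s) := by
    funext t
    exact deriv_comp_sub_const f s t
  rw [packet, packet, e, map_sub, map_smul, UnitaryGroup.op_smear hf,
    UnitaryGroup.op_smear hf.deriv]

theorem op_neg_packet (hf : IsTest f) (s : ℝ) :
    U.op (-s) (packet ħ U a b f) = packet ħ U a b fun t => f (t + s) := by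
  rw [op_packet hf]
  simp

theorem continuous_correlation_shift (hf : IsTest f) :
    Continuous fun s => correlation ħ U a b fun t => f (t + s) := by
  have e : ∀ s, deriv (fun t => f (t + s)) = fun t => deriv f (t + s) := fun s => by
    funext t
    exact deriv_comp_add_const f s t
  have hc : ∀ x : 𝓗, Continuous fun s => U.op (-s) x := fun x =>
    (U.continuous_op x).comp continuous_neg
  simp only [correlation, e, ← op_neg_packet hf, ← op_neg_packet hf.deriv]
  exact ((hc _).inner continuous_const).add (((hc _).const_smul _).inner continuous_const)

theorem IsHamiltonian.packet_mem_graph (hH : IsHamiltonian ħ H U) (hħ : ħ ≠ 0) (a b : 𝓗)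
    (hf : IsTest f) :
    (packet ħ U a b f, (-Complex.I * ħ) • packet ħ U a b (deriv f)) ∈ H.graph := by
  have h := H.graph.sub_mem (hH.smear_mem_graph hħ hf a)
    (H.graph.smul_mem (Complex.I * ħ) (hH.smear_mem_graph hħ hf.deriv b))
  convert h using 1
  simp only [packet, Prod.smul_mk, Prod.mk_sub_mk]
  congr 1
  module

theorem IsHamiltonian.packet_mem (hH : IsHamiltonian ħ H U) (hħ : ħ ≠ 0) (a b : 𝓗)
    (hf : IsTest f) : packet ħ U a b f ∈ H.domain :=
  H.mem_domain_of_mem_graph (hH.packet_mem_graph hħ a b hf)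

/-- Since `⟪φ, U(t) b⟫ = ⟪U(-t) φ, b⟫` has derivative `-(i/ħ) ⟪H φ, U(t) b⟫`, integration by parts
trades `H` on `φ` for a derivative on `f`. This is the origin of the formula for `packet`. -/
theorem isPacket_packet (hH : IsHamiltonian ħ H U) (hħ : ħ ≠ 0)
    (hab : ∀ φ : H.domain, ψ.amp φ = ⟪(φ : 𝓗), a⟫_ℂ + ⟪H φ, b⟫_ℂ) (hf : IsTest f) :
    IsPacket hH ψ f (packet ħ U a b f) := by
  intro φ
  have hħ' : (ħ : ℂ) ≠ 0 := by exact_mod_cast hħ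
  have c1 : ∀ x y : 𝓗, Continuous fun t => ⟪x, U.op t y⟫_ℂ := fun x y =>
    continuous_const.inner (U.continuous_op y)
  have hd : ∀ t, HasDerivAt (fun t => ⟪(φ : 𝓗), U.op t b⟫_ℂ)
      ((-Complex.I / ħ) * ⟪H φ, U.op t b⟫_ℂ) t := fun t => by
    have h := (hH.hasDerivAt_op_neg (H.mem_graph φ) t).inner ℂ (hasDerivAt_const t b)
    have h' : HasDerivAt (fun t => ⟪U.op (-t) (φ : 𝓗), b⟫_ℂ)
        ((-Complex.I / ħ) * ⟪U.op (-t) (H φ), b⟫_ℂ) t := by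
      refine h.congr_deriv ?_
      rw [inner_zero_right, zero_add, inner_smul_left]
      simp
    simpa only [U.inner_op_neg_left] using h'
  have hparts := integral_mul_deriv_eq_deriv_mul_of_integrable
    (fun t _ => (hf.differentiable t).hasDerivAt) (fun t _ => hd t)
    (hf.integrable_smul (continuous_const.mul (c1 _ _)))
    (hf.deriv.integrable_smul (c1 _ _)) (hf.integrable_smul (c1 _ _))
  have e : ∀ t, f t * ((-Complex.I / ħ) * ⟪H φ, U.op t b⟫_ℂ) =
      (-Complex.I / ħ) * (f t * ⟪H φ, U.op t b⟫_ℂ) := fun t => by ring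
  simp only [e, integral_const_mul] at hparts
  simp only [Ket.amp_evolve hab, mul_add]
  rw [integral_add (f := fun t => f t * ⟪(φ : 𝓗), U.op t a⟫_ℂ)
    (g := fun t => f t * ⟪H φ, U.op t b⟫_ℂ)
    (hf.integrable_smul (c1 _ _)) (hf.integrable_smul (c1 _ _)), packet,
    inner_sub_right, inner_smul_right, UnitaryGroup.inner_smear hf,
    UnitaryGroup.inner_smear hf.deriv, sub_eq_add_neg, ← mul_neg, ← hparts]
  congr 1
  field_simp
  simp

theorem isPacket_iff (hH : IsHamiltonian ħ H U) (hħ : ħ ≠ 0)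
    (hab : ∀ φ : H.domain, ψ.amp φ = ⟪(φ : 𝓗), a⟫_ℂ + ⟪H φ, b⟫_ℂ) (hf : IsTest f) {v : 𝓗} :
    IsPacket hH ψ f v ↔ v = packet ħ U a b f := by
  refine ⟨fun h => ?_, fun h => h ▸ isPacket_packet hH hħ hab hf⟩
  refine sub_eq_zero.1 (hH.eq_zero_of_forall_inner_eq_zero hħ fun φ => ?_)
  rw [inner_sub_right, h φ, isPacket_packet hH hħ hab hf φ, sub_self]

theorem amp_evolve_packet (hH : IsHamiltonian ħ H U) (hħ : ħ ≠ 0)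
    (hab : ∀ φ : H.domain, ψ.amp φ = ⟪(φ : 𝓗), a⟫_ℂ + ⟪H φ, b⟫_ℂ) (hf : IsTest f) (s : ℝ)
    {v : H.domain} (hv : (v : 𝓗) = packet ħ U a b f) :
    (ψ.evolve hH s).amp v = correlation ħ U a b fun t => f (t + s) := by
  change ψ.amp ⟨U.op (-s) (v : 𝓗), hH.op_mem (-s) v⟩ = _
  have hs := hf.comp_add_right s
  have hgr := hH.packet_mem_graph hħ a b hs
  have e : (⟨U.op (-s) (v : 𝓗), hH.op_mem (-s) v⟩ : H.domain) =
      ⟨_, H.mem_domain_of_mem_graph hgr⟩ := Subtype.ext (by simp only [hv, op_neg_packet hf])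
  rw [e, hab, correlation]
  congr 2
  exact H.mem_graph_snd_inj (H.mem_graph _) hgr rfl

/-- Because `ψ[f]` lies in `D(H)`, it may serve as the test vector in the defining property of
`ψ[g]`; evolving the ket to time `s` then shifts `f`. -/
theorem inner_packet_packet (hH : IsHamiltonian ħ H U) (hħ : ħ ≠ 0)
    (hab : ∀ φ : H.domain, ψ.amp φ = ⟪(φ : 𝓗), a⟫_ℂ + ⟪H φ, b⟫_ℂ) (hf : IsTest f)
    (hg : IsTest g) :
    ⟪packet ħ U a b f, packet ħ U a b g⟫_ℂ =
      ∫ s, g s * correlation ħ U a b fun t => f (t + s) := by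
  have h := isPacket_packet hH hħ hab hg ⟨_, hH.packet_mem hħ a b hf⟩
  have e : ∀ s, (ψ.evolve hH s).amp ⟨_, hH.packet_mem hħ a b hf⟩ =
      correlation ħ U a b fun t => f (t + s) := fun s => amp_evolve_packet hH hħ hab hf s rfl
  simpa only [e] using h

theorem isOrthogonalOn_iff (hH : IsHamiltonian ħ H U) (hħ : ħ ≠ 0)
    (hab : ∀ φ : H.domain, ψ.amp φ = ⟪(φ : 𝓗), a⟫_ℂ + ⟪H φ, b⟫_ℂ) (s : ℝ) (J : Set ℝ) :
    IsOrthogonalOn hH ψ s J ↔ ∀ f : ℝ → ℂ, IsTest f → tsupport f ⊆ J →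
      correlation ħ U a b (fun t => f (t + s)) = 0 := by
  refine forall_congr' fun f => forall_congr' fun hf => forall_congr' fun _ =>
    ⟨fun h => ?_, fun h v hv => ?_⟩
  · rw [← amp_evolve_packet hH hħ hab hf s (v := ⟨_, hH.packet_mem hħ a b hf⟩) rfl]
    exact h _ (isPacket_packet hH hħ hab hf)
  · rw [amp_evolve_packet hH hħ hab hf s ((isPacket_iff hH hħ hab hf).1 hv), h]

end

end Packets

section Distributions

/-! ### Antilinear distributions supported at the origin -/

/-- A smooth cutoff, equal to `1` on `[-1, 1]` and to `0` outside `[-2, 2]`. -/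
def cutoff (t : ℝ) : ℝ :=
  1 - Real.smoothTransition (t - 1) - Real.smoothTransition (-t - 1)

theorem contDiff_cutoff : ContDiff ℝ ∞ cutoff := by
  have h : ContDiff ℝ ∞ Real.smoothTransition := Real.smoothTransition.contDiff
  exact (contDiff_const.sub (h.comp (contDiff_id.sub contDiff_const))).sub
    (h.comp (contDiff_neg.sub contDiff_const))

theorem cutoff_eq_one {t : ℝ} (ht : |t| ≤ 1) : cutoff t = 1 := by
  rw [abs_le] at ht
  rw [cutoff, Real.smoothTransition.zero_of_nonpos (by linarith),
    Real.smoothTransition.zero_of_nonpos (by linarith), sub_zero, sub_zero]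

theorem tsupport_cutoff_subset : tsupport cutoff ⊆ Set.Icc (-2) 2 := by
  refine closure_minimal (fun t ht => ?_) isClosed_Icc
  by_contra h
  apply ht
  rw [Set.mem_Icc, not_and_or, not_le, not_le] at h
  rcases h with h | h
  · rw [cutoff, Real.smoothTransition.zero_of_nonpos (by linarith),
      Real.smoothTransition.one_of_one_le (by linarith), sub_zero, sub_self]
  · rw [cutoff, Real.smoothTransition.one_of_one_le (by linarith),
      Real.smoothTransition.zero_of_nonpos (by linarith), sub_self, sub_zero]

theorem hasCompactSupport_cutoff : HasCompactSupport cutoff :=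
  isCompact_Icc.of_isClosed_subset (isClosed_tsupport _) tsupport_cutoff_subset

theorem isTest_cutoff : IsTest fun t => (cutoff t : ℂ) :=
  .ofReal contDiff_cutoff hasCompactSupport_cutoff

theorem tsupport_ofReal_cutoff_subset : tsupport (fun t => (cutoff t : ℂ)) ⊆ Set.Icc (-2) 2 :=
  (tsupport_comp_subset (g := Complex.ofReal) Complex.ofReal_zero cutoff).trans
    tsupport_cutoff_subset

theorem deriv_ofReal_cutoff_zero : deriv (fun t => (cutoff t : ℂ)) 0 = 0 := by
  have h : (fun t => (cutoff t : ℂ)) =ᶠ[nhds 0] fun _ => 1 := by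
    filter_upwards [Metric.closedBall_mem_nhds (0 : ℝ) one_pos] with t ht
    rw [cutoff_eq_one (by simpa using ht), Complex.ofReal_one]
  rw [h.deriv_eq, deriv_const]

theorem IsTest.exists_norm_le {f : ℝ → ℂ} (hf : IsTest f) : ∃ K : ℝ, ∀ t, ‖f t‖ ≤ K :=
  hf.continuous.bounded_above_of_compact_support hf.2

theorem contDiff_comp_mul_left {g : ℝ → ℂ} (hg : IsTest g) (l : ℝ) :
    ContDiff ℝ ∞ fun t => g (l * t) :=
  hg.1.comp (contDiff_const.mul contDiff_id)

theorem deriv_scaled_mul {g r : ℝ → ℂ} (hg : IsTest g) (hr : IsTest r) (l : ℝ) :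
    deriv (fun t => g (l * t) * r t) =
      fun t => (l : ℂ) * (deriv g (l * t) * r t) + g (l * t) * deriv r t := by
  funext t
  have h1 : HasDerivAt (fun t => g (l * t)) (l • deriv g (l * t)) t := by
    have := (hg.differentiable (l * t)).hasDerivAt.scomp t ((hasDerivAt_id t).const_mul l)
    simpa [Function.comp_def] using this
  rw [(h1.fun_mul (hr.differentiable t).hasDerivAt).deriv, Complex.real_smul]
  ring

theorem integral_norm_le_of_eq_zero_off {F : ℝ → ℂ} {δ B : ℝ} (hδ : 0 ≤ δ)
    (hB : ∀ t, |t| ≤ δ → ‖F t‖ ≤ B) (h0 : ∀ t, δ < |t| → F t = 0) :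
    ∫ t, ‖F t‖ ≤ B * (2 * δ) := by
  have h1 : ∫ t, ‖F t‖ = ∫ t in Set.Icc (-δ) δ, ‖F t‖ := by
    refine (setIntegral_eq_integral_of_forall_compl_eq_zero fun t ht => ?_).symm
    rw [h0 t (lt_of_not_ge fun h => ht (abs_le.1 h)), norm_zero]
  rw [h1]
  have h2 := norm_setIntegral_le_of_norm_le_const (μ := volume) (s := Set.Icc (-δ) δ)
    (f := fun t => ‖F t‖) (C := B) (by simp) fun t ht => by
      rw [norm_norm]
      exact hB t (abs_le.2 ht)
  refine (le_abs_self _).trans (h2.trans_eq ?_)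
  rw [Real.volume_real_Icc, max_eq_left (by linarith)]
  ring

/-- The mean value inequality, applied to `deriv r` and then to `r` on the segment from `0` to `t`;
the missing Taylor factor `1/2` is immaterial. -/
theorem norm_le_of_deriv_zero {r : ℝ → ℂ} (hr : Differentiable ℝ r)
    (hr' : Differentiable ℝ (deriv r)) (h0 : r 0 = 0) (h1 : deriv r 0 = 0)
    {M : ℝ} (hM : ∀ t, ‖deriv (deriv r) t‖ ≤ M) (t : ℝ) :
    ‖deriv r t‖ ≤ M * |t| ∧ ‖r t‖ ≤ M * |t| * |t| := by
  have h2 : ∀ t, ‖deriv r t‖ ≤ M * |t| := fun t => by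
    have := convex_univ.norm_image_sub_le_of_norm_deriv_le (𝕜 := ℝ) (f := deriv r) (C := M)
      (x := 0) (y := t) (fun x _ => hr' x) (fun x _ => hM x) trivial trivial
    simpa [h1] using this
  refine ⟨h2 t, ?_⟩
  have := (convex_uIcc 0 t).norm_image_sub_le_of_norm_deriv_le (𝕜 := ℝ) (f := r)
    (C := M * |t|) (x := 0) (y := t) (fun x _ => hr x) (fun x hx => (h2 x).trans ?_)
    Set.left_mem_uIcc Set.right_mem_uIcc
  · simpa [h0] using this
  · have : |x| ≤ |t| := by simpa using Set.abs_sub_left_of_mem_uIcc hx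
    have hM0 : 0 ≤ M := (norm_nonneg _).trans (hM 0)
    gcongr

section

variable {T : (ℝ → ℂ) → ℂ} {C : ℝ}

/-- The part of `r` near the origin, in the Sobolev norm that bounds the distribution, is small with
the size of the cutoff if `r` vanishes to second order. -/
theorem exists_norm_scaled_cutoff_le (hC : 0 ≤ C)
    (hbd : ∀ f, ‖T f‖ ≤
      C * ((∫ t, ‖f t‖) + (∫ t, ‖deriv f t‖) + ∫ t, ‖deriv (deriv f) t‖))
    {r : ℝ → ℂ} (hr : IsTest r) (h0 : r 0 = 0) (h1 : deriv r 0 = 0) :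
    ∃ D : ℝ, ∀ ε : ℝ, 0 < ε → ε ≤ 1 →
      ‖T fun t => (cutoff (ε⁻¹ * t) : ℂ) * r t‖ ≤ D * ε := by
  set κ : ℝ → ℂ := fun t => (cutoff t : ℂ) with hκdef
  have hκ : IsTest κ := isTest_cutoff
  obtain ⟨K0, hK0⟩ := hκ.exists_norm_le
  obtain ⟨K1, hK1⟩ := hκ.deriv.exists_norm_le
  obtain ⟨K2, hK2⟩ := hκ.deriv.deriv.exists_norm_le
  obtain ⟨M, hM⟩ := hr.deriv.deriv.exists_norm_le
  have hM0 : 0 ≤ M := (norm_nonneg _).trans (hM 0)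
  have hK00 : 0 ≤ K0 := (norm_nonneg _).trans (hK0 0)
  have hK10 : 0 ≤ K1 := (norm_nonneg _).trans (hK1 0)
  have hK20 : 0 ≤ K2 := (norm_nonneg _).trans (hK2 0)
  -- A crude common bound: each of the three integrands is at most a sum of four products of some
  -- `K0`, `K1`, `K2` with `4 * M`. Each is integrated over `[-2ε, 2ε]`, of length `4 * ε`.
  set B : ℝ := 4 * (K0 + K1 + K2) * M * 4 with hB
  refine ⟨C * (3 * (B * 4)), fun ε hε hε1 => ?_⟩
  set l := ε⁻¹ with hl
  have hl0 : 0 < l := inv_pos.2 hε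
  have hκ0 : ∀ t, 2 < |t| → κ t = 0 ∧ deriv κ t = 0 ∧ deriv (deriv κ) t = 0 := fun t ht => by
    have h : t ∉ tsupport κ := fun h => by
      have := abs_le.2 (Set.mem_Icc.1 (tsupport_ofReal_cutoff_subset h))
      linarith
    have h' : t ∉ tsupport (deriv κ) := fun h2 => h (tsupport_deriv_subset h2)
    exact ⟨image_eq_zero_of_notMem_tsupport h, image_eq_zero_of_notMem_tsupport h',
      image_eq_zero_of_notMem_tsupport fun h2 => h' (tsupport_deriv_subset h2)⟩
  have hfar : ∀ t, 2 * ε < |t| → 2 < |l * t| := fun t ht => by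
    rw [abs_mul, abs_of_pos hl0, hl, inv_mul_eq_div, lt_div_iff₀ hε]
    exact ht
  have hnear : ∀ t, |t| ≤ 2 * ε → |t| ≤ 2 ∧ l * |t| ≤ 2 := fun t ht => by
    refine ⟨by linarith, ?_⟩
    rw [hl, inv_mul_eq_div, div_le_iff₀ hε]
    exact ht
  have hr' := norm_le_of_deriv_zero hr.differentiable hr.deriv.differentiable h0 h1 hM
  have d1 := deriv_scaled_mul hκ hr l
  have d2 : deriv (deriv fun t => κ (l * t) * r t) = fun t =>
      (l : ℂ) * ((l : ℂ) * (deriv (deriv κ) (l * t) * r t) + deriv κ (l * t) * deriv r t) +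
      ((l : ℂ) * (deriv κ (l * t) * deriv r t) + κ (l * t) * deriv (deriv r) t) := by
    have t1 := hr.mul_left (contDiff_comp_mul_left hκ.deriv l)
    have t2 := hr.deriv.mul_left (contDiff_comp_mul_left hκ l)
    rw [d1]
    funext t
    rw [deriv_fun_add ((t1.differentiable t).const_mul _) (t2.differentiable t),
      deriv_const_mul _ (t1.differentiable t), deriv_scaled_mul hκ.deriv hr,
      deriv_scaled_mul hκ hr.deriv]
  have nl : ‖(l : ℂ)‖ = l := by rw [Complex.norm_real, Real.norm_of_nonneg hl0.le]
  -- Every factor `l = ε⁻¹` produced by differentiating the cutoff is absorbed by a factor `|t| ≤ 2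
  -- * ε`; vanishing to second order provides enough of them.
  have bnd : ∀ t, |t| ≤ 2 * ε → ‖r t‖ ≤ 4 * M ∧ ‖deriv r t‖ ≤ 4 * M ∧ l * ‖r t‖ ≤ 4 * M ∧
      l * ‖deriv r t‖ ≤ 4 * M ∧ l * (l * ‖r t‖) ≤ 4 * M := fun t ht => by
    obtain ⟨a1, a2⟩ := hnear t ht
    obtain ⟨b1, b2⟩ := hr' t
    have ha := abs_nonneg t
    have hla : 0 ≤ l * |t| := by positivity
    refine ⟨?_, ?_, ?_, ?_, ?_⟩
    · calc ‖r t‖ ≤ M * |t| * |t| := b2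
        _ ≤ M * 2 * 2 := by gcongr
        _ = _ := by ring
    · calc ‖deriv r t‖ ≤ M * |t| := b1
        _ ≤ M * 4 := by gcongr; linarith
        _ = _ := by ring
    · calc l * ‖r t‖ ≤ l * (M * |t| * |t|) := by gcongr
        _ = M * (l * |t|) * |t| := by ring
        _ ≤ M * 2 * 2 := by gcongr
        _ = _ := by ring
    · calc l * ‖deriv r t‖ ≤ l * (M * |t|) := by gcongr
        _ = M * (l * |t|) := by ring
        _ ≤ M * 4 := by gcongr; linarith
        _ = _ := by ring
    · calc l * (l * ‖r t‖) ≤ l * (l * (M * |t| * |t|)) := by gcongr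
        _ = M * (l * |t|) * (l * |t|) := by ring
        _ ≤ M * 2 * 2 := by gcongr
        _ = _ := by ring
  have hM4 : ∀ t, ‖deriv (deriv r) t‖ ≤ 4 * M := fun t => (hM t).trans (by linarith)
  have i0 : ∫ t, ‖κ (l * t) * r t‖ ≤ B * (2 * (2 * ε)) := by
    refine integral_norm_le_of_eq_zero_off (by positivity) (fun t ht => ?_) fun t ht => by
      rw [(hκ0 _ (hfar t ht)).1, zero_mul]
    obtain ⟨b1, -⟩ := bnd t ht
    calc ‖κ (l * t) * r t‖ ≤ K0 * (4 * M) := by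
          rw [norm_mul]
          gcongr
          exact hK0 _
      _ ≤ B := by rw [hB]; nlinarith [mul_nonneg hK00 hM0, mul_nonneg hK10 hM0, mul_nonneg hK20 hM0]
  have i1 : ∫ t, ‖deriv (fun t => κ (l * t) * r t) t‖ ≤ B * (2 * (2 * ε)) := by
    rw [d1]
    refine integral_norm_le_of_eq_zero_off (by positivity) (fun t ht => ?_) fun t ht => by
      rw [(hκ0 _ (hfar t ht)).1, (hκ0 _ (hfar t ht)).2.1]
      ring
    obtain ⟨-, b2, b3, -⟩ := bnd t ht
    calc _ ≤ ‖deriv κ (l * t)‖ * (l * ‖r t‖) + ‖κ (l * t)‖ * ‖deriv r t‖ := by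
          refine (norm_add_le _ _).trans_eq ?_
          simp only [norm_mul, nl]
          ring
      _ ≤ K1 * (4 * M) + K0 * (4 * M) := by
          gcongr
          exacts [hK1 _, hK0 _]
      _ ≤ B := by rw [hB]; nlinarith [mul_nonneg hK00 hM0, mul_nonneg hK10 hM0, mul_nonneg hK20 hM0]
  have i2 : ∫ t, ‖deriv (deriv fun t => κ (l * t) * r t) t‖ ≤ B * (2 * (2 * ε)) := by
    rw [d2]
    refine integral_norm_le_of_eq_zero_off (by positivity) (fun t ht => ?_) fun t ht => by
      rw [(hκ0 _ (hfar t ht)).1, (hκ0 _ (hfar t ht)).2.1, (hκ0 _ (hfar t ht)).2.2]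
      ring
    obtain ⟨-, -, -, b4, b5⟩ := bnd t ht
    calc _ = ‖deriv (deriv κ) (l * t) * (l * (l * r t)) + deriv κ (l * t) * (l * deriv r t) +
              deriv κ (l * t) * (l * deriv r t) + κ (l * t) * deriv (deriv r) t‖ := by
          congr 1
          ring
      _ ≤ ‖deriv (deriv κ) (l * t)‖ * (l * (l * ‖r t‖)) + ‖deriv κ (l * t)‖ * (l * ‖deriv r t‖) +
          ‖deriv κ (l * t)‖ * (l * ‖deriv r t‖) + ‖κ (l * t)‖ * ‖deriv (deriv r) t‖ := by
          refine norm_add₄_le.trans_eq ?_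
          simp only [norm_mul, nl]
      _ ≤ K2 * (4 * M) + K1 * (4 * M) + K1 * (4 * M) + K0 * (4 * M) := by
          gcongr
          exacts [hK2 _, hK1 _, hK1 _, hK0 _, hM4 t]
      _ ≤ B := by rw [hB]; nlinarith [mul_nonneg hK00 hM0, mul_nonneg hK10 hM0, mul_nonneg hK20 hM0]
  calc _ ≤ C * (B * (2 * (2 * ε)) + B * (2 * (2 * ε)) + B * (2 * (2 * ε))) :=
        (hbd _).trans (by gcongr)
    _ = _ := by ring

/-- At scale `ε`, `r` splits into a left, a right and a central piece. The outer two are annihilated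
by the support hypotheses, and the central one contributes `O(ε)`. -/
theorem eq_zero_of_vanishing_second_order
    (hadd : ∀ f g, IsTest f → IsTest g → T (fun t => f t + g t) = T f + T g) (hC : 0 ≤ C)
    (hbd : ∀ f, ‖T f‖ ≤
      C * ((∫ t, ‖f t‖) + (∫ t, ‖deriv f t‖) + ∫ t, ‖deriv (deriv f) t‖))
    (hneg : ∀ f, IsTest f → tsupport f ⊆ Set.Iio 0 → T f = 0)
    (hpos : ∀ f, IsTest f → tsupport f ⊆ Set.Ioi 0 → T f = 0)
    {r : ℝ → ℂ} (hr : IsTest r) (h0 : r 0 = 0) (h1 : deriv r 0 = 0) : T r = 0 := by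
  obtain ⟨D, hD⟩ := exists_norm_scaled_cutoff_le hC hbd hr h0 h1
  have key : ∀ ε : ℝ, 0 < ε → ε ≤ 1 → ‖T r‖ ≤ D * ε := fun ε hε hε1 => by
    have hs : ContDiff ℝ ∞ fun t : ℝ => (Real.smoothTransition (ε⁻¹ * t - 1) : ℂ) :=
      Complex.ofRealCLM.contDiff.comp
        (Real.smoothTransition.contDiff.comp ((contDiff_const.mul contDiff_id).sub contDiff_const))
    have hs' : ContDiff ℝ ∞ fun t : ℝ => (Real.smoothTransition (-(ε⁻¹ * t) - 1) : ℂ) :=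
      Complex.ofRealCLM.contDiff.comp (Real.smoothTransition.contDiff.comp
        ((contDiff_const.mul contDiff_id).neg.sub contDiff_const))
    have hp := hr.mul_left hs
    have hn := hr.mul_left hs'
    have hz := hr.mul_left (contDiff_comp_mul_left isTest_cutoff ε⁻¹)
    have Tp := hpos _ hp <| (closure_minimal (t := Set.Ici ε) (fun t ht => by
      by_contra h
      apply ht
      have : ε⁻¹ * t - 1 ≤ 0 := by
        rw [sub_nonpos, inv_mul_eq_div, div_le_one hε]
        exact (lt_of_not_ge h).le
      simp only [Real.smoothTransition.zero_of_nonpos this, Complex.ofReal_zero, zero_mul])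
      isClosed_Ici).trans fun t ht => hε.trans_le ht
    have Tn := hneg _ hn <| (closure_minimal (t := Set.Iic (-ε)) (fun t ht => by
      by_contra h
      apply ht
      have : -(ε⁻¹ * t) - 1 ≤ 0 := by
        rw [sub_nonpos, ← mul_neg, inv_mul_eq_div, div_le_one hε]
        have : -ε < t := lt_of_not_ge h
        linarith
      simp only [Real.smoothTransition.zero_of_nonpos this, Complex.ofReal_zero, zero_mul])
      isClosed_Iic).trans fun t ht => by
        have : t ≤ -ε := ht
        exact this.trans_lt (by linarith)
    -- The partition of unity built into the definition of `cutoff`.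
    have e : r = fun t => ((Real.smoothTransition (ε⁻¹ * t - 1) : ℂ) * r t +
        (Real.smoothTransition (-(ε⁻¹ * t) - 1) : ℂ) * r t) + (cutoff (ε⁻¹ * t) : ℂ) * r t := by
      funext t
      rw [cutoff]
      push_cast
      ring
    rw [e, hadd _ _ (hp.add hn) hz, hadd _ _ hp hn, Tp, Tn, zero_add, zero_add]
    exact hD ε hε hε1
  have lim : Filter.Tendsto (fun ε : ℝ => D * ε) (nhdsWithin 0 (Set.Ioi 0)) (nhds 0) := by
    have : Filter.Tendsto (fun ε : ℝ => D * ε) (nhds 0) (nhds (D * 0)) :=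
      (continuous_const.mul continuous_id).tendsto 0
    rw [mul_zero] at this
    exact this.mono_left nhdsWithin_le_nhds
  refine norm_le_zero_iff.1 (ge_of_tendsto lim ?_)
  filter_upwards [Ioc_mem_nhdsGT one_pos] with ε hε using key ε hε.1 hε.2

/-- An antilinear distribution supported at the origin and bounded in the norm of `W^{2,1}` is a
combination of the Dirac distribution and its first derivative. -/
theorem exists_eq_dirac_add_deriv_dirac
    (hadd : ∀ f g, IsTest f → IsTest g → T (fun t => f t + g t) = T f + T g)
    (hsmul : ∀ (c : ℂ) f, IsTest f → T (fun t => c * f t) = (starRingEnd ℂ) c * T f) (hC : 0 ≤ C)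
    (hbd : ∀ f, ‖T f‖ ≤
      C * ((∫ t, ‖f t‖) + (∫ t, ‖deriv f t‖) + ∫ t, ‖deriv (deriv f) t‖))
    (hneg : ∀ f, IsTest f → tsupport f ⊆ Set.Iio 0 → T f = 0)
    (hpos : ∀ f, IsTest f → tsupport f ⊆ Set.Ioi 0 → T f = 0) :
    ∃ c₀ c₁ : ℂ, ∀ f, IsTest f →
      T f = c₀ * (starRingEnd ℂ) (f 0) + c₁ * (starRingEnd ℂ) (deriv f 0) := by
  set κ : ℝ → ℂ := fun t => (cutoff t : ℂ) with hκdef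
  have hκ : IsTest κ := isTest_cutoff
  have κ0 : κ 0 = 1 := by rw [hκdef]; simp [cutoff_eq_one (t := 0) (by simp)]
  have hι : IsTest fun t : ℝ => (t : ℂ) * κ t := hκ.mul_left Complex.ofRealCLM.contDiff
  have dι : deriv (fun t : ℝ => (t : ℂ) * κ t) 0 = 1 := by
    have := (Complex.ofRealCLM.hasDerivAt (x := (0 : ℝ))).mul (hκ.differentiable 0).hasDerivAt
    refine HasDerivAt.deriv (this.congr_deriv ?_)
    simp [κ0]
  -- The functions `κ` and `t κ` have value and slope `(1, 0)` and `(0, 1)` at the origin;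
  -- subtracting `f 0` and `deriv f 0` times them leaves a remainder vanishing to second order.
  refine ⟨T κ, T fun t => (t : ℂ) * κ t, fun f hf => ?_⟩
  have tκ := hκ.const_mul (-f 0)
  have tι := hι.const_mul (-deriv f 0)
  have h := eq_zero_of_vanishing_second_order hadd hC hbd hneg hpos (hf.add (tκ.add tι))
    (by simp [κ0]) (by
      rw [deriv_fun_add (hf.differentiable 0) ((tκ.add tι).differentiable 0),
        deriv_fun_add (tκ.differentiable 0) (tι.differentiable 0),
        deriv_const_mul _ (hκ.differentiable 0), deriv_const_mul _ (hι.differentiable 0), dι,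
        deriv_ofReal_cutoff_zero]
      ring)
  rw [hadd _ _ hf (tκ.add tι), hadd _ _ tκ tι, hsmul _ _ hκ, hsmul _ _ hι] at h
  simp only [map_neg] at h
  linear_combination h

end

end Distributions

section Correlation

variable {𝓗 : Type*} [NormedAddCommGroup 𝓗] [InnerProductSpace ℂ 𝓗]

/-! ### The autocorrelation of an orthogonal history -/

section

variable [CompleteSpace 𝓗] {ħ : ℝ} {H : 𝓗 →ₗ.[ℂ] 𝓗} {U : UnitaryGroup 𝓗} {a b : 𝓗} {ψ : Ket H}

/-- Hermitian symmetry of the autocorrelation: if it vanishes on an open set, it vanishes on the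
reflected set. -/
theorem correlation_eq_zero_of_neg (hH : IsHamiltonian ħ H U) (hħ : ħ ≠ 0)
    (hab : ∀ φ : H.domain, ψ.amp φ = ⟪(φ : 𝓗), a⟫_ℂ + ⟪H φ, b⟫_ℂ) {J : Set ℝ} (hJ : IsOpen J)
    (h : ∀ f, IsTest f → tsupport f ⊆ J → correlation ħ U a b f = 0) {f : ℝ → ℂ}
    (hf : IsTest f) (hfJ : ∀ t ∈ tsupport f, -t ∈ J) : correlation ħ U a b f = 0 := by
  -- Compactness leaves a margin `δ` around the support. For `g` supported in the `δ`-ball, symmetry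
  -- of the inner product turns `∫ g(s) T(f(· + s))` into the conjugate of `∫ f(s) T(g(· + s))`; for
  -- `s` in the support of `f`, the shifted `g` lives near `-s`, inside `J`. So `T(f(· + s))`
  -- vanishes for `|s| < δ`, in particular at `s = 0`.
  obtain ⟨δ, hδ, hsub⟩ := hf.2.isCompact.exists_thickening_subset_open
    (hJ.preimage continuous_neg) hfJ
  have hk := eqOn_zero_of_integral_test_mul_eq_zero
    (continuous_correlation_shift (ħ := ħ) (U := U) (a := a) (b := b) hf)
    (Metric.isOpen_ball (x := (0 : ℝ)) (ε := δ)) fun g hg hgs => ?_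
  · simpa using hk (Metric.mem_ball_self hδ)
  rw [← inner_packet_packet hH hħ hab hf hg, ← inner_conj_symm,
    inner_packet_packet hH hħ hab hg hf, integral_eq_zero_of_ae, map_zero]
  refine Filter.Eventually.of_forall fun s => ?_
  by_cases hs : s ∈ tsupport f
  · have hsupp : tsupport (fun t => g (t + s)) ⊆ (fun t => t + s) ⁻¹' tsupport g :=
      closure_minimal (fun t ht => subset_tsupport g ht)
        ((isClosed_tsupport g).preimage (continuous_id.add continuous_const))
    have h0 := h _ (hg.comp_add_right s) (hsupp.trans fun t ht => by
      have h1 : t + s ∈ Metric.ball (0 : ℝ) δ := hgs ht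
      have h2 : -t ∈ Metric.thickening δ (tsupport f) := by
        refine Metric.mem_thickening_iff.2 ⟨s, hs, ?_⟩
        rw [Real.dist_eq, ← abs_neg]
        rw [Metric.mem_ball, Real.dist_eq, sub_zero] at h1
        convert h1 using 2
        ring
      simpa using hsub h2)
    simp only [h0, mul_zero, Pi.zero_apply]
  · simp only [image_eq_zero_of_notMem_tsupport hs, zero_mul, Pi.zero_apply]

theorem exists_correlation_eq (hH : IsHamiltonian ħ H U) (hħ : ħ ≠ 0)
    (hab : ∀ φ : H.domain, ψ.amp φ = ⟪(φ : 𝓗), a⟫_ℂ + ⟪H φ, b⟫_ℂ)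
    (horth : IsOrthogonalOn hH ψ 0 (Set.Iio 0) ∨ IsOrthogonalOn hH ψ 0 (Set.Ioi 0)) :
    ∃ c₀ c₁ : ℂ, ∀ f, IsTest f → correlation ħ U a b f =
      c₀ * (starRingEnd ℂ) (f 0) + c₁ * (starRingEnd ℂ) (deriv f 0) := by
  obtain ⟨C, hC, hbd⟩ := exists_norm_correlation_le ħ U a b
  simp only [isOrthogonalOn_iff hH hħ hab, add_zero] at horth
  have hneg : ∀ f, IsTest f → tsupport f ⊆ Set.Iio 0 → correlation ħ U a b f = 0 := by
    rcases horth with h | h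
    · exact h
    · exact fun f hf hs => correlation_eq_zero_of_neg hH hħ hab isOpen_Ioi h hf
        fun t ht => Set.mem_Ioi.2 (neg_pos.2 (hs ht))
  have hpos : ∀ f, IsTest f → tsupport f ⊆ Set.Ioi 0 → correlation ħ U a b f = 0 :=
    fun f hf hs => correlation_eq_zero_of_neg hH hħ hab isOpen_Iio hneg hf
        fun t ht => Set.mem_Iio.2 (neg_lt_zero.2 (hs ht))
  exact exists_eq_dirac_add_deriv_dirac (fun f g => correlation_add)
    (fun c f => correlation_const_mul c) hC hbd hneg hpos

theorem eq_zero_of_forall_add_mul_nonneg {z w : ℂ}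
    (h : ∀ l : ℝ, 0 ≤ (z + l * w).re ∧ (z + l * w).im = 0) : w = 0 := by
  have hi : w.im = 0 := by
    have h0 := (h 0).2
    have h1 := (h 1).2
    simp at h0 h1
    linarith
  refine Complex.ext ?_ hi
  by_contra hw
  have hw' : w.re ≠ 0 := hw
  -- This choice of `l` would make the real part `-1`.
  have h1 := (h (-(z.re + 1) / w.re)).1
  rw [Complex.add_re, Complex.re_ofReal_mul, div_mul_cancel₀ _ hw'] at h1
  linarith

/-- The plane wave of frequency `l` with the envelope `cutoff`. -/
def modulated (l t : ℝ) : ℂ := Complex.exp (l * t * Complex.I) * cutoff t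

theorem isTest_modulated (l : ℝ) : IsTest (modulated l) :=
  isTest_cutoff.mul_left (Complex.contDiff_exp.comp
    ((contDiff_const.mul Complex.ofRealCLM.contDiff).mul contDiff_const))

theorem deriv_modulated (l t : ℝ) : deriv (modulated l) t =
    Complex.exp (l * t * Complex.I) * (l * Complex.I * cutoff t + (deriv cutoff t : ℝ)) := by
  have h1 : HasDerivAt (fun t : ℝ => (l : ℂ) * t * Complex.I) (l * Complex.I) t := by
    have := ((Complex.ofRealCLM.hasDerivAt (x := t)).const_mul (l : ℂ)).mul_const Complex.I
    simpa using this
  have h2 := ((contDiff_cutoff.differentiable (by simp)) t).hasDerivAt.ofReal_comp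
  have h3 : deriv (modulated l) t = _ := (h1.cexp.fun_mul h2).deriv
  rw [h3]
  ring

theorem exp_mul_conj_exp (l t : ℝ) : Complex.exp (l * t * Complex.I) *
    (starRingEnd ℂ) (Complex.exp (l * t * Complex.I)) = 1 := by
  rw [← Complex.exp_conj, ← Complex.exp_add]
  simp

theorem modulated_mul_conj (l t : ℝ) :
    modulated l t * (starRingEnd ℂ) (modulated l t) = ((cutoff t ^ 2 : ℝ) : ℂ) := by
  rw [modulated, map_mul, Complex.conj_ofReal]
  push_cast
  linear_combination (cutoff t : ℂ) ^ 2 * exp_mul_conj_exp l t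

theorem modulated_mul_conj_deriv (l t : ℝ) :
    modulated l t * (starRingEnd ℂ) (deriv (modulated l) t) =
      -(l * Complex.I) * ((cutoff t ^ 2 : ℝ) : ℂ) + ((cutoff t * deriv cutoff t : ℝ) : ℂ) := by
  rw [deriv_modulated, modulated, map_mul, map_add, map_mul, map_mul, Complex.conj_ofReal,
    Complex.conj_ofReal, Complex.conj_ofReal, Complex.conj_I]
  push_cast
  linear_combination (cutoff t * (-(l * Complex.I) * cutoff t + (deriv cutoff t : ℝ)) : ℂ) *
    exp_mul_conj_exp l t

theorem continuous_cutoff_sq : Continuous fun t => cutoff t ^ 2 :=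
  contDiff_cutoff.continuous.pow 2

theorem hasCompactSupport_cutoff_sq : HasCompactSupport fun t => cutoff t ^ 2 :=
  hasCompactSupport_cutoff.comp_left (g := fun x : ℝ => x ^ 2) (zero_pow two_ne_zero)

theorem integrable_cutoff_sq : Integrable fun t => cutoff t ^ 2 :=
  continuous_cutoff_sq.integrable_of_hasCompactSupport hasCompactSupport_cutoff_sq

theorem integral_cutoff_sq_pos : 0 < ∫ t, cutoff t ^ 2 := by
  refine continuous_cutoff_sq.integral_pos_of_hasCompactSupport_nonneg_nonzero
    (x := 0) hasCompactSupport_cutoff_sq (fun t => sq_nonneg _) ?_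
  simp [cutoff_eq_one (t := 0) (by simp)]

/-- The autocorrelation is positive, so there is no derivative term. -/
theorem correlation_deriv_coeff_eq_zero (hH : IsHamiltonian ħ H U) (hħ : ħ ≠ 0)
    (hab : ∀ φ : H.domain, ψ.amp φ = ⟪(φ : 𝓗), a⟫_ℂ + ⟪H φ, b⟫_ℂ) {c₀ c₁ : ℂ}
    (hc : ∀ f, IsTest f → correlation ħ U a b f =
      c₀ * (starRingEnd ℂ) (f 0) + c₁ * (starRingEnd ℂ) (deriv f 0)) :
    c₁ = 0 := by
  set A : ℝ := ∫ t, cutoff t ^ 2 with hA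
  set B : ℝ := ∫ t, cutoff t * deriv cutoff t with hB
  have iB : Integrable fun t => cutoff t * deriv cutoff t :=
    (contDiff_cutoff.continuous.mul (contDiff_cutoff.continuous_deriv (by simp))
      ).integrable_of_hasCompactSupport hasCompactSupport_cutoff.mul_right
  -- The squared norm of the modulated packet is affine in the frequency `l`, with slope
  -- proportional to `c₁`; nonnegativity for all real `l` forces the slope to vanish.
  have key : ∀ l : ℝ, ⟪packet ħ U a b (modulated l), packet ħ U a b (modulated l)⟫_ℂ =
      (c₀ * A + c₁ * B) + l * (-Complex.I * c₁ * A) := by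
    intro l
    have hf := isTest_modulated l
    rw [inner_packet_packet hH hħ hab hf hf]
    have e : ∀ s : ℝ, modulated l s * correlation ħ U a b (fun t => modulated l (t + s)) =
        (c₀ - l * Complex.I * c₁) * ((cutoff s ^ 2 : ℝ) : ℂ) +
          c₁ * ((cutoff s * deriv cutoff s : ℝ) : ℂ) := fun s => by
      rw [hc _ (hf.comp_add_right s), deriv_comp_add_const, zero_add]
      linear_combination c₀ * modulated_mul_conj l s + c₁ * modulated_mul_conj_deriv l s
    simp only [e]
    rw [integral_add (integrable_cutoff_sq.ofReal.const_mul _) (iB.ofReal.const_mul _),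
      integral_const_mul, integral_const_mul, integral_complex_ofReal, integral_complex_ofReal]
    ring
  have h0 := eq_zero_of_forall_add_mul_nonneg (z := c₀ * A + c₁ * B)
    (w := -Complex.I * c₁ * A) fun l => by
      rw [← key l]
      exact ⟨inner_self_nonneg (𝕜 := ℂ), inner_self_im (𝕜 := ℂ) _⟩
  simpa [integral_cutoff_sq_pos.ne', hA] using h0

/-- The autocorrelation of a nonzero ket orthogonal to its past or its future is a positive multiple
of the Dirac distribution. -/
theorem exists_correlation_eq_dirac (hH : IsHamiltonian ħ H U) (hħ : ħ ≠ 0)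
    (hab : ∀ φ : H.domain, ψ.amp φ = ⟪(φ : 𝓗), a⟫_ℂ + ⟪H φ, b⟫_ℂ) (hψ : ψ.amp ≠ 0)
    (horth : IsOrthogonalOn hH ψ 0 (Set.Iio 0) ∨ IsOrthogonalOn hH ψ 0 (Set.Ioi 0)) :
    ∃ c : ℝ, 0 < c ∧ ∀ f, IsTest f →
      correlation ħ U a b f = (c : ℂ) ^ 2 * (starRingEnd ℂ) (f 0) := by
  obtain ⟨c₀, c₁, hc⟩ := exists_correlation_eq hH hħ hab horth
  obtain rfl := correlation_deriv_coeff_eq_zero hH hħ hab hc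
  simp only [zero_mul, add_zero] at hc
  have hin : ∀ f, IsTest f → ⟪packet ħ U a b f, packet ħ U a b f⟫_ℂ =
      c₀ * ((∫ t, ‖f t‖ ^ 2 : ℝ) : ℂ) := fun f hf => by
    rw [inner_packet_packet hH hħ hab hf hf, ← integral_complex_ofReal, ← integral_const_mul]
    refine integral_congr_ae (Filter.Eventually.of_forall fun s => ?_)
    simp only [hc _ (hf.comp_add_right s), zero_add]
    rw [mul_left_comm, Complex.mul_conj']
    simp
  -- If `c₀ = 0`, all packets vanish, so the continuous function `t ↦ ⟨φ|ψ(t)⟩` integrates to zero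
  -- against every test function and is zero at `t = 0`.
  have hne : c₀ ≠ 0 := fun h0 => hψ <| by
    have hP : ∀ f, IsTest f → packet ħ U a b f = 0 := fun f hf => by
      rw [← inner_self_eq_zero (𝕜 := ℂ), hin f hf, h0, zero_mul]
    ext φ
    have hk := eqOn_zero_of_integral_test_mul_eq_zero
      (Ket.continuous_amp_evolve (hH := hH) hab φ) isOpen_univ fun f hf _ => by
        rw [← isPacket_packet hH hħ hab hf φ, hP f hf, inner_zero_right]
    have : (ψ.evolve hH 0).amp φ = 0 := hk (Set.mem_univ 0)
    rw [Ket.amp_evolve hab] at this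
    simpa [U.op_zero, ← hab] using this
  have hpos := integral_cutoff_sq_pos
  have hin0 := hin _ isTest_cutoff
  have him : c₀.im = 0 := by
    have h := inner_self_im (𝕜 := ℂ) (packet ħ U a b fun t => (cutoff t : ℂ))
    rw [hin0] at h
    simpa [Complex.mul_im, hpos.ne'] using h
  have hre : 0 ≤ c₀.re := by
    have h := inner_self_nonneg (𝕜 := ℂ) (x := packet ħ U a b fun t => (cutoff t : ℂ))
    rw [hin0] at h
    exact nonneg_of_mul_nonneg_left (by simpa [Complex.mul_re] using h) hpos
  have hre' : 0 < c₀.re := hre.lt_of_ne' fun h => hne (Complex.ext h him)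
  refine ⟨√c₀.re, Real.sqrt_pos.2 hre', fun f hf => ?_⟩
  rw [hc f hf, ← Complex.ofReal_pow, Real.sq_sqrt hre]
  congr 1
  exact Complex.ext rfl (by simpa using him)

end

/-! ### Cores of the restricted Hamiltonian -/

theorem op_mem_closure_span {U : UnitaryGroup 𝓗} {D : Set 𝓗} (hinv : ∀ t, ∀ v ∈ D, U.op t v ∈ D)
    (t : ℝ) {x : 𝓗} (hx : x ∈ (Submodule.span ℂ D).topologicalClosure) :
    U.op t x ∈ (Submodule.span ℂ D).topologicalClosure := by
  have h : (Submodule.span ℂ D).topologicalClosure ≤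
      (Submodule.span ℂ D).topologicalClosure.comap (U.op t).toLinearEquiv.toLinearMap := by
    refine Submodule.topologicalClosure_minimal _ (Submodule.span_le.2 fun v hv => ?_) ?_
    · exact Submodule.le_topologicalClosure _ (Submodule.subset_span (hinv t v hv))
    · exact (Submodule.isClosed_topologicalClosure _).preimage (U.op t).continuous
  exact h hx

/-- The Hamiltonian leaves invariant every closed subspace invariant under the evolution. -/
theorem IsHamiltonian.mem_of_invariant {ħ : ℝ} {H : 𝓗 →ₗ.[ℂ] 𝓗} {U : UnitaryGroup 𝓗}
    (hH : IsHamiltonian ħ H U) (hħ : ħ ≠ 0) {V : Submodule ℂ 𝓗} (hV : IsClosed (V : Set 𝓗))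
    (hinv : ∀ t, ∀ x ∈ V, U.op t x ∈ V) {x y : 𝓗} (h : (x, y) ∈ H.graph) (hx : x ∈ V) :
    y ∈ V := by
  have h1 := (hasDerivAt_iff_tendsto_slope_zero.1 ((hH x y).1 h))
  have h2 : (-Complex.I / ħ) • y ∈ V := by
    refine hV.mem_of_tendsto h1 (Filter.Eventually.of_forall fun t => ?_)
    exact (V.restrictScalars ℝ).smul_mem _ (V.sub_mem (hinv _ _ hx) (hinv _ _ hx))
  refine (V.smul_mem_iff (s := -Complex.I / ħ) ?_).1 h2
  have : (ħ : ℂ) ≠ 0 := by exact_mod_cast hħ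
  simp [this]

variable [CompleteSpace 𝓗] in
/-- An invariant set of vectors in the domain of the Hamiltonian is a core for the restriction of
the Hamiltonian to the closed subspace it spans: it suffices to test `H x = y` against it. -/
theorem IsHamiltonian.mem_graph_of_forall_inner {ħ : ℝ} {H : 𝓗 →ₗ.[ℂ] 𝓗} {U : UnitaryGroup 𝓗}
    (hH : IsHamiltonian ħ H U) {D : Set 𝓗}
    (hD : ∀ v ∈ D, v ∈ H.domain) (hinv : ∀ t, ∀ v ∈ D, U.op t v ∈ D) {x y : 𝓗}
    (hx : x ∈ (Submodule.span ℂ D).topologicalClosure)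
    (hy : y ∈ (Submodule.span ℂ D).topologicalClosure)
    (h : ∀ v ∈ D, ∀ w, (v, w) ∈ H.graph → ⟪w, x⟫_ℂ = ⟪v, y⟫_ℂ) : (x, y) ∈ H.graph := by
  set V := (Submodule.span ℂ D).topologicalClosure with hV
  set k : ℝ → 𝓗 := fun s => (-Complex.I / ħ) • U.op s y with hk
  have kc : Continuous k := (U.continuous_op y).const_smul _
  set I : ℝ → 𝓗 := fun t => ∫ s in (0 : ℝ)..t, k s with hI
  have dI : ∀ t, HasDerivAt I (k t) t := fun t => kc.integral_hasStrictDerivAt 0 t |>.hasDerivAt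
  have hI0 : I 0 = 0 := intervalIntegral.integral_same
  -- The goal is `U(t) x = x + I(t)`, whose derivative at `0` is the claim. The defect is orthogonal
  -- to any `u` against which the orbit of `x` has the expected derivative.
  have weak : ∀ u : 𝓗, (∀ s, HasDerivAt (fun s => ⟪u, U.op s x⟫_ℂ) ⟪u, k s⟫_ℂ s) →
      ∀ t, ⟪u, U.op t x - x - I t⟫_ℂ = 0 := fun u hu t => by
    have d : ∀ s, HasDerivAt (fun s => ⟪u, U.op s x⟫_ℂ - ⟪u, I s⟫_ℂ) 0 s := fun s => by
      have h1 : HasDerivAt (fun s => ⟪u, I s⟫_ℂ) ⟪u, k s⟫_ℂ s := by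
        have := (hasDerivAt_const s u).inner ℂ (dI s)
        simpa using this
      simpa using (hu s).fun_sub h1
    have e := is_const_of_deriv_eq_zero (fun s => (d s).differentiableAt) (fun s => (d s).deriv) t 0
    rw [hI0, inner_zero_right, sub_zero, U.op_zero] at e
    rw [inner_sub_right, inner_sub_right]
    linear_combination e
  have hz : ∀ t, U.op t x - x - I t ∈ Vᗮ := fun t => by
    rw [hV, Submodule.orthogonal_closure, Submodule.mem_orthogonal]
    intro u hu
    refine Submodule.span_induction (p := fun u _ => ⟪u, U.op t x - x - I t⟫_ℂ = 0)
      (fun v hv => weak v (fun s => ?_) t) (inner_zero_left _)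
      (fun u v _ _ hu hv => by rw [inner_add_left, hu, hv, add_zero])
      (fun c u _ hu => by rw [inner_smul_left, hu, mul_zero]) hu
    have hg := H.mem_graph ⟨v, hD v hv⟩
    have d := (hH.hasDerivAt_op_neg hg s).inner ℂ (hasDerivAt_const s x)
    have d' : HasDerivAt (fun t => ⟪U.op (-t) v, x⟫_ℂ) ⟪v, k s⟫_ℂ s := by
      refine d.congr_deriv ?_
      rw [inner_zero_right, zero_add, inner_smul_left,
        h _ (hinv (-s) v hv) _ (hH.mem_graph (-s) hg), hk, inner_smul_right, U.inner_op_neg_left]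
      simp
    simpa only [U.inner_op_neg_left] using d'
  -- The defect, now known to lie in `Vᗮ`, is itself an admissible `u`: the orbits of `x` and `y`
  -- stay in `V`, so both sides of the derivative condition are zero. Hence it is orthogonal to
  -- itself.
  have hz0 : ∀ t, U.op t x = x + I t := fun t => by
    have h0 := weak (U.op t x - x - I t) (fun s => ?_) t
    · rw [inner_self_eq_zero, sub_sub, sub_eq_zero] at h0
      exact h0
    have o : ∀ v ∈ V, ∀ s, ⟪U.op t x - x - I t, U.op s v⟫_ℂ = 0 := fun v hv s =>
      Submodule.inner_left_of_mem_orthogonal (op_mem_closure_span hinv s hv) (hz t)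
    simp only [hk, inner_smul_right, o x hx, o y hy, mul_zero]
    exact hasDerivAt_const _ _
  rw [hH]
  have d := (dI 0).const_add x
  simp only [hk, U.op_zero] at d
  simpa only [hz0] using d

end Correlation

section Representation

/-! ### The time representation -/

/-- The space of test functions. -/
def testSpace : Submodule ℂ (ℝ → ℂ) where
  carrier := {f | IsTest f}
  add_mem' hf hg := hf.add hg
  zero_mem' := ⟨contDiff_const, HasCompactSupport.zero⟩
  smul_mem' c _ hf := hf.const_mul c

theorem IsTest.memLp {f : ℝ → ℂ} (hf : IsTest f) : MemLp f 2 (volume : Measure ℝ) :=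
  hf.continuous.memLp_of_hasCompactSupport hf.2

/-- The inclusion of the test functions in `L²(ℝ)`. -/
def testToLp : testSpace →ₗ[ℂ] Lp ℂ 2 (volume : Measure ℝ) where
  toFun f := (IsTest.memLp f.2).toLp f.1
  map_add' _ _ := rfl
  map_smul' _ _ := rfl

theorem denseRange_testToLp : DenseRange testToLp := by
  refine (Lp.dense_hasCompactSupport_contDiff (μ := (volume : Measure ℝ)) (F := ℂ)
    (p := 2) (by simp)).mono ?_
  rintro u ⟨g, hg, hc, hd⟩
  refine ⟨⟨g, hd, hc⟩, Lp.ext ?_⟩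
  exact (MemLp.coeFn_toLp (IsTest.memLp ⟨hd, hc⟩)).trans hg.symm

theorem coeFn_testToLp (f : testSpace) : (testToLp f : ℝ → ℂ) =ᵐ[volume] f.1 :=
  MemLp.coeFn_toLp (IsTest.memLp f.2)

theorem inner_testToLp (f : testSpace) (g : Lp ℂ 2 (volume : Measure ℝ)) :
    ⟪testToLp f, g⟫_ℂ = ∫ t, (starRingEnd ℂ) (f.1 t) * g t := by
  rw [L2.inner_def]
  refine integral_congr_ae ?_
  filter_upwards [coeFn_testToLp f] with t ht
  rw [RCLike.inner_apply, ht, mul_comm]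

theorem deriv_conj (f : ℝ → ℂ) (t : ℝ) :
    deriv (fun t => (starRingEnd ℂ) (f t)) t = (starRingEnd ℂ) (deriv f t) :=
  deriv.star

variable {𝓗 : Type*} [NormedAddCommGroup 𝓗] [InnerProductSpace ℂ 𝓗] [CompleteSpace 𝓗]
  {ħ : ℝ} {H : 𝓗 →ₗ.[ℂ] 𝓗} {U : UnitaryGroup 𝓗} {a b : 𝓗} {ψ : Ket H}

theorem packet_mem_historySpan (hH : IsHamiltonian ħ H U) (hħ : ħ ≠ 0)
    (hab : ∀ φ : H.domain, ψ.amp φ = ⟪(φ : 𝓗), a⟫_ℂ + ⟪H φ, b⟫_ℂ) {f : ℝ → ℂ} (hf : IsTest f) :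
    packet ħ U a b f ∈ historySpan hH ψ :=
  Submodule.le_topologicalClosure _
    (Submodule.subset_span ⟨f, hf, isPacket_packet hH hħ hab hf⟩)

/-- The wave packets of `ψ`, as a linear map to the space spanned by the history. -/
def packetMap (hH : IsHamiltonian ħ H U) (hħ : ħ ≠ 0)
    (hab : ∀ φ : H.domain, ψ.amp φ = ⟪(φ : 𝓗), a⟫_ℂ + ⟪H φ, b⟫_ℂ) :
    testSpace →ₗ[ℂ] historySpan hH ψ where
  toFun f := ⟨packet ħ U a b f.1, packet_mem_historySpan hH hħ hab f.2⟩
  map_add' f g := Subtype.ext (packet_add f.2 g.2)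
  map_smul' c f := Subtype.ext (packet_const_mul c f.2)

theorem denseRange_packetMap (hH : IsHamiltonian ħ H U) (hħ : ħ ≠ 0)
    (hab : ∀ φ : H.domain, ψ.amp φ = ⟪(φ : 𝓗), a⟫_ℂ + ⟪H φ, b⟫_ℂ) :
    DenseRange (packetMap hH hħ hab) := by
  refine Topology.IsInducing.subtypeVal.dense_iff.2 fun x => ?_
  have h : Submodule.span ℂ {v : 𝓗 | ∃ f : ℝ → ℂ, IsTest f ∧ IsPacket hH ψ f v} ≤
      ((packetMap hH hħ hab).range.map (historySpan hH ψ).subtype) := by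
    refine Submodule.span_le.2 ?_
    rintro v ⟨f, hf, hv⟩
    obtain rfl := (isPacket_iff hH hħ hab hf).1 hv
    exact ⟨_, ⟨⟨f, hf⟩, rfl⟩, rfl⟩
  have hx : (x : 𝓗) ∈ closure (Submodule.span ℂ
      {v : 𝓗 | ∃ f : ℝ → ℂ, IsTest f ∧ IsPacket hH ψ f v} : Set 𝓗) := x.2
  refine closure_mono h hx

theorem op_packet_mem (hH : IsHamiltonian ħ H U) (hħ : ħ ≠ 0)
    (hab : ∀ φ : H.domain, ψ.amp φ = ⟪(φ : 𝓗), a⟫_ℂ + ⟪H φ, b⟫_ℂ) (t : ℝ) :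
    ∀ v ∈ {v : 𝓗 | ∃ f : ℝ → ℂ, IsTest f ∧ IsPacket hH ψ f v},
      U.op t v ∈ {v : 𝓗 | ∃ f : ℝ → ℂ, IsTest f ∧ IsPacket hH ψ f v} := by
  rintro v ⟨f, hf, hv⟩
  rw [isPacket_iff hH hħ hab hf] at hv
  rw [hv, op_packet hf]
  exact ⟨_, hf.comp_sub_right t, isPacket_packet hH hħ hab (hf.comp_sub_right t)⟩

theorem op_mem_historySpan (hH : IsHamiltonian ħ H U) (hħ : ħ ≠ 0)
    (hab : ∀ φ : H.domain, ψ.amp φ = ⟪(φ : 𝓗), a⟫_ℂ + ⟪H φ, b⟫_ℂ) (t : ℝ) (x : 𝓗)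
    (hx : x ∈ historySpan hH ψ) : U.op t x ∈ historySpan hH ψ :=
  op_mem_closure_span (op_packet_mem hH hħ hab) t hx

instance (hH : IsHamiltonian ħ H U) : CompleteSpace (historySpan hH ψ) :=
  (Submodule.isClosed_topologicalClosure _).completeSpace_coe

/-- If the autocorrelation is a multiple of the Dirac distribution, the wave packets are isometric,
up to a factor, to their profiles in `L²(ℝ)`. -/
theorem exists_time_representation (hH : IsHamiltonian ħ H U) (hħ : ħ ≠ 0)
    (hab : ∀ φ : H.domain, ψ.amp φ = ⟪(φ : 𝓗), a⟫_ℂ + ⟪H φ, b⟫_ℂ) {c : ℝ} (hc : 0 < c)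
    (hcorr : ∀ f, IsTest f →
      correlation ħ U a b f = (c : ℂ) ^ 2 * (starRingEnd ℂ) (f 0)) :
    ∃ W : historySpan hH ψ ≃ₗᵢ[ℂ] Lp ℂ 2 (volume : Measure ℝ),
      ∀ f : testSpace, W (packetMap hH hħ hab f) = (c : ℂ) • testToLp f := by
  have hcne : (c : ℂ) ≠ 0 := by exact_mod_cast hc.ne'
  have hdense : DenseRange ((c : ℂ) • testToLp) :=
    (Homeomorph.smulOfNeZero (c : ℂ) hcne).surjective.denseRange.comp denseRange_testToLp
      (Homeomorph.continuous _)
  have hnorm : ∀ f : testSpace, ‖((c : ℂ) • testToLp) (LinearEquiv.refl ℂ testSpace f)‖ =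
      ‖packetMap hH hħ hab f‖ := fun f => by
    have h1 : ⟪packet ħ U a b f.1, packet ħ U a b f.1⟫_ℂ =
        ⟪(c : ℂ) • testToLp f, (c : ℂ) • testToLp f⟫_ℂ := by
      rw [inner_smul_left, inner_smul_right, inner_testToLp, inner_packet_packet hH hħ hab f.2 f.2,
        Complex.conj_ofReal, ← mul_assoc, ← pow_two, ← integral_const_mul]
      refine integral_congr_ae ?_
      filter_upwards [coeFn_testToLp f] with s hs
      rw [hcorr _ (IsTest.comp_add_right f.2 s), zero_add, hs]
      ring
    rw [inner_self_eq_norm_sq_to_K, inner_self_eq_norm_sq_to_K] at h1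
    have h2 : ‖packet ħ U a b f.1‖ ^ 2 = ‖(c : ℂ) • testToLp f‖ ^ 2 := by exact_mod_cast h1
    exact ((pow_left_inj₀ (norm_nonneg _) (norm_nonneg _) two_ne_zero).1 h2).symm
  exact ⟨(LinearEquiv.refl ℂ testSpace).extendOfIsometry (packetMap hH hħ hab)
    ((c : ℂ) • testToLp) (denseRange_packetMap hH hħ hab) hdense hnorm,
    fun f => LinearEquiv.extendOfIsometry_eq _ _ _ _ _ hnorm f⟩

section

variable {c : ℝ} {hH : IsHamiltonian ħ H U} {hħ : ħ ≠ 0}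
  {hab : ∀ φ : H.domain, ψ.amp φ = ⟪(φ : 𝓗), a⟫_ℂ + ⟪H φ, b⟫_ℂ}
  {W : historySpan hH ψ ≃ₗᵢ[ℂ] Lp ℂ 2 (volume : Measure ℝ)}

/-- Both sides are continuous in `x` and agree on packets, where evolution shifts the profile. -/
theorem time_representation_op
    (hW : ∀ f : testSpace, W (packetMap hH hħ hab f) = (c : ℂ) • testToLp f) (t : ℝ)
    (x : historySpan hH ψ) :
    (W ⟨U.op t (x : 𝓗), op_mem_historySpan hH hħ hab t x x.2⟩ : ℝ → ℂ)
      =ᵐ[volume] fun τ => W x (τ - t) := by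
  have hmp := measurePreserving_sub_right (volume : Measure ℝ) t
  set R := Lp.compMeasurePreservingₗᵢ (E := ℂ) (p := 2) ℂ (fun τ : ℝ => τ - t) hmp with hR
  have hRc : ∀ g : Lp ℂ 2 (volume : Measure ℝ), (R g : ℝ → ℂ) =ᵐ[volume] fun τ => g (τ - t) :=
    fun g => Lp.coeFn_compMeasurePreserving g hmp
  have key : ∀ x : historySpan hH ψ,
      W ⟨U.op t (x : 𝓗), op_mem_historySpan hH hħ hab t x x.2⟩ = R (W x) := by
    have c1 : Continuous fun x : historySpan hH ψ =>
        W ⟨U.op t (x : 𝓗), op_mem_historySpan hH hħ hab t x x.2⟩ :=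
      W.continuous.comp (((U.op t).continuous.comp continuous_subtype_val).subtype_mk _)
    have c2 : Continuous fun x : historySpan hH ψ => R (W x) := R.continuous.comp W.continuous
    refine fun x => congrFun ((denseRange_packetMap hH hħ hab).equalizer c1 c2 ?_) x
    funext f
    let g : testSpace := ⟨fun s => f.1 (s - t), IsTest.comp_sub_right f.2 t⟩
    have e : (⟨U.op t (packetMap hH hħ hab f : 𝓗),
        op_mem_historySpan hH hħ hab t _ (packetMap hH hħ hab f).2⟩ : historySpan hH ψ) =
        packetMap hH hħ hab g := Subtype.ext (op_packet f.2 t)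
    have e2 : R (testToLp f) = testToLp g := by
      refine Lp.ext ((hRc _).trans ?_)
      exact (hmp.quasiMeasurePreserving.ae_eq_comp (coeFn_testToLp f)).trans
        (coeFn_testToLp g).symm
    simp only [Function.comp_apply]
    rw [e, hW, hW, map_smul, e2]
  rw [key x]
  exact hRc _

theorem inner_packet_eq_integral
    (hW : ∀ f : testSpace, W (packetMap hH hħ hab f) = (c : ℂ) • testToLp f) {f : ℝ → ℂ}
    (hf : IsTest f) (x : historySpan hH ψ) :
    ⟪packet ħ U a b f, (x : 𝓗)⟫_ℂ = c * ∫ t, (starRingEnd ℂ) (f t) * W x t := by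
  have h := W.inner_map_map (packetMap hH hħ hab ⟨f, hf⟩) x
  rw [hW, inner_smul_left, inner_testToLp, Complex.conj_ofReal] at h
  exact h.symm

theorem integral_mul_const_smul (φ : ℝ → ℂ) (z : ℂ) (g : Lp ℂ 2 (volume : Measure ℝ)) :
    ∫ t, φ t * (z • g) t = z * ∫ t, φ t * g t := by
  rw [← integral_const_mul]
  refine integral_congr_ae ?_
  filter_upwards [Lp.coeFn_smul z g] with t ht
  rw [ht, Pi.smul_apply, smul_eq_mul]
  ring

/-- Read through `W`, the identity `⟪H ψ[f], x⟫ = ⟪ψ[f], y⟫` for all `f` is the weak derivative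
relation, tested against `conj f`. Symmetry of `H` yields it from the graph; the core property of
the packets gives the converse. -/
theorem time_representation_hamiltonian (hc : c ≠ 0)
    (hW : ∀ f : testSpace, W (packetMap hH hħ hab f) = (c : ℂ) • testToLp f)
    (x y : historySpan hH ψ) : ((x : 𝓗), (y : 𝓗)) ∈ H.graph ↔
      ∃ g' : Lp ℂ 2 (volume : Measure ℝ),
        HasWeakDeriv (W x) g' ∧ W y = (-Complex.I * (ħ : ℂ)) • g' := by
  have hcne : (c : ℂ) ≠ 0 := by exact_mod_cast hc
  have hħne : (ħ : ℂ) ≠ 0 := by exact_mod_cast hħ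
  have hleft : ∀ f : ℝ → ℂ, IsTest f → ⟪(-Complex.I * ħ) • packet ħ U a b (deriv f), (x : 𝓗)⟫_ℂ =
      (Complex.I * ħ) * (c * ∫ t, (starRingEnd ℂ) (deriv f t) * W x t) := fun f hf => by
    rw [inner_smul_left, inner_packet_eq_integral hW hf.deriv]
    simp
  constructor
  · intro h
    refine ⟨(Complex.I / ħ) • W y, fun φ hφ => ?_, ?_⟩
    · have e := hH.inner_symm hħ (hH.packet_mem_graph hħ a b hφ.conj) h
      rw [hleft _ hφ.conj, inner_packet_eq_integral hW hφ.conj] at e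
      simp only [deriv_conj, Complex.conj_conj] at e
      rw [integral_mul_const_smul]
      have e2 : (Complex.I * ħ) * ∫ t, deriv φ t * W x t = ∫ t, φ t * W y t :=
        mul_left_cancel₀ hcne (by linear_combination e)
      rw [← e2]
      field_simp
      rw [Complex.I_sq]
      ring
    · rw [smul_smul]
      have : -Complex.I * (ħ : ℂ) * (Complex.I / ħ) = 1 := by
        field_simp
        simp
      rw [this, one_smul]
  · rintro ⟨g', hg', hy⟩
    refine hH.mem_graph_of_forall_inner ?_ (op_packet_mem hH hħ hab) x.2 y.2 ?_
    · rintro v ⟨f, hf, hv⟩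
      rw [(isPacket_iff hH hħ hab hf).1 hv]
      exact hH.packet_mem hħ a b hf
    · rintro v ⟨f, hf, hv⟩ w hw
      obtain rfl := (isPacket_iff hH hħ hab hf).1 hv
      obtain rfl := H.mem_graph_snd_inj hw (hH.packet_mem_graph hħ a b hf) rfl
      have e := hg' _ hf.conj
      simp only [deriv_conj] at e
      rw [hleft f hf, inner_packet_eq_integral hW hf, hy, integral_mul_const_smul, e]
      ring

end

end Representation

end QuantumHistory

end

/-! ### The main theorem -/

open QuantumHistory in
theorem theorem1 {𝓗 : Type*} [NormedAddCommGroup 𝓗] [InnerProductSpace ℂ 𝓗] [CompleteSpace 𝓗]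
    (ħ : ℝ) (hħ : 0 < ħ) (H : 𝓗 →ₗ.[ℂ] 𝓗) (U : UnitaryGroup 𝓗) (hH : IsHamiltonian ħ H U)
    (ψ : Ket H) (hψ : ψ.amp ≠ 0)
    (horth : IsOrthogonalOn hH ψ 0 (Set.Iio 0) ∨ IsOrthogonalOn hH ψ 0 (Set.Ioi 0)) :
    -- the superpositions of states in the history exist (in the domain of the Hamiltonian)
    (∀ f : ℝ → ℂ, IsTest f → ∃ v : H.domain, IsPacket hH ψ f (v : 𝓗)) ∧
    -- the states at distinct times are orthogonal
    (∀ s : ℝ, IsOrthogonalOn hH ψ s {s}ᶜ) ∧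
    -- the spanned space is invariant under the evolution and the Hamiltonian
    ∃ hU : ∀ (t : ℝ) (x : 𝓗), x ∈ historySpan hH ψ → U.op t x ∈ historySpan hH ψ,
    (∀ x : H.domain, (x : 𝓗) ∈ historySpan hH ψ → H x ∈ historySpan hH ψ) ∧
    -- it is identified with `L²(ℝ)`
    ∃ W : historySpan hH ψ ≃ₗᵢ[ℂ] Lp ℂ 2 (volume : Measure ℝ),
      -- `|ψ(t)⟩` corresponds to a multiple of the Dirac ket `|τ = t⟩`
      (∃ c : ℝ, 0 < c ∧ ∀ f : ℝ → ℂ, IsTest f → ∀ v : historySpan hH ψ,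
        IsPacket hH ψ f (v : 𝓗) → (W v : ℝ → ℂ) =ᵐ[volume] fun τ => (c : ℂ) * f τ) ∧
      -- the evolution acts as translation
      (∀ (t : ℝ) (x : historySpan hH ψ),
        (W ⟨U.op t (x : 𝓗), hU t x x.2⟩ : ℝ → ℂ) =ᵐ[volume] fun τ => W x (τ - t)) ∧
      -- the restricted Hamiltonian is `-iħ d/dτ`, with domain the Sobolev space `H¹(ℝ)`
      (∀ x y : historySpan hH ψ, ((x : 𝓗), (y : 𝓗)) ∈ H.graph ↔
        ∃ g' : Lp ℂ 2 (volume : Measure ℝ),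
          HasWeakDeriv (W x) g' ∧ W y = (-Complex.I * (ħ : ℂ)) • g') := by
  obtain ⟨a, b, hab⟩ := ψ.exists_amp_eq
  obtain ⟨c, hc, hcorr⟩ := exists_correlation_eq_dirac hH hħ.ne' hab hψ horth
  obtain ⟨W, hW⟩ := exists_time_representation hH hħ.ne' hab hc hcorr
  refine ⟨fun f hf => ⟨⟨_, hH.packet_mem hħ.ne' a b hf⟩, isPacket_packet hH hħ.ne' hab hf⟩,
    fun s => ?_, op_mem_historySpan hH hħ.ne' hab, fun x hx => ?_, W,
    ⟨c, hc, fun f hf v hv => ?_⟩, time_representation_op hW,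
    time_representation_hamiltonian hc.ne' hW⟩
  · rw [isOrthogonalOn_iff hH hħ.ne' hab]
    intro f hf hs
    rw [hcorr _ (hf.comp_add_right s), zero_add,
      image_eq_zero_of_notMem_tsupport fun h => hs h rfl, map_zero, mul_zero]
  · exact hH.mem_of_invariant hħ.ne' (Submodule.isClosed_topologicalClosure _)
      (op_mem_historySpan hH hħ.ne' hab) (H.mem_graph x) hx
  · have e : v = packetMap hH hħ.ne' hab ⟨f, hf⟩ :=
      Subtype.ext ((isPacket_iff hH hħ.ne' hab hf).1 hv)
    rw [e, hW]
    filter_upwards [Lp.coeFn_smul (c : ℂ) (testToLp ⟨f, hf⟩), coeFn_testToLp ⟨f, hf⟩] with τ h1 h2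
    rw [h1, Pi.smul_apply, h2, smul_eq_mul]
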